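/- Let $K$ be a field, $n \ge 0$, and $S = K[x_1,\dots,x_n]$ with its $\mathbb{Z}^n$-grading, $\deg x_i = e_i$. Let $\mathrm{Mod}$ be the category of $\mathbb{Z}^n$-graded $S$-modules and degree-preserving $S$-linear maps; write $M(a)$ for the module $M$ with the grading $M(a)_b = M_{a+b}$, and $\sigma_a(M) = M(-a)$. Order $\mathbb{Z}^n$ componentwise and let $t \in \mathbb{N}^n$ with $t \ge \mathbf{1} = (1,\dots,1)$. For $u \in \mathbb{N}^n$, let $\mathrm{Mod}_u$ be the full subcategory of $\mathrm{Mod}$ of the positively $u$-determined modules: those $M$ that are finitely generated, satisfy $M_a = 0$ for $a \notin \mathbb{N}^n$, and for which $x_i : M_a \to M_{a+e_i}$ is bijective whenever $a_i \ge u_i$. For an order-preserving map $q : \mathbb{N}^n \to \mathbb{Z}^n$, let $q^* : \mathrm{Mod} \to \mathrm{Mod}$ be the functor with $(q^*M)_a = M_{q(a)}$ for $a \in \mathbb{N}^n$ and $(q^*M)_a = 0$ otherwise, where $x^c$ acts from degree $a$ to degree $a+c$ as $x^{q(a+c)-q(a)}$, and $(q^*f)_a = f_{q(a)}$. Let $r$,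 $s$ and, for $u \in \mathbb{N}^n$, $p_u$ be the order-preserving maps $\mathbb{N}^n \to \mathbb{Z}^n$ with $$r(a)_i = \begin{cases} t_i & a_i > 0\\ 0 & a_i = 0\end{cases},\qquad s(a)_i = \begin{cases} t_i & a_i \ge 1\\ t_i - 1 & a_i = 0\end{cases},\qquad p_u(a)_i = \min(a_i, u_i).$$ Let ${}^*\mathrm{Hom}_S(M,N) = \bigoplus_{a\in\mathbb{Z}^n} \mathrm{Hom}_{\mathrm{Mod}}(M, N(a))$, and let $E = K[x_1^{-1},\dots,x_n^{-1}]$ be the graded injective hull of $K$. For $u \in \mathbb{N}^n$ define contravariant functors $\mathrm{Mod} \to \mathrm{Mod}$ by $$D_u(M) = \sigma_u\big({}^*\mathrm{Hom}_S(M,S)\big), \qquad A_u(M) = p_u^*\big({}^*\mathrm{Hom}_S(M(u),E)\big).$$ Then the functors $A_{\mathbf 1}\circ D_{\mathbf 1}\circ r^*$, $p_{\mathbf 1}^*\circ A_t\circ D_t$, $r^*\circ A_t\circ D_t$ and $A_{\mathbf 1}\circ D_{\mathbf 1}\circ s^*$, restricted to $\mathrm{Mod}_t$, take values in $\mathrm{Mod}_{\mathbf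 1}$, and there are natural isomorphisms $$A_{\mathbf 1}\circ D_{\mathbf 1}\circ r^* \;\cong\; p_{\mathbf 1}^*\circ A_t\circ D_t \qquad\text{and}\qquad r^*\circ A_t\circ D_t \;\cong\; A_{\mathbf 1}\circ D_{\mathbf 1}\circ s^*$$ of functors $\mathrm{Mod}_t \to \mathrm{Mod}_{\mathbf 1}$. -/

import Mathlib

open CategoryTheory

noncomputable section

universe u

namespace MultigradedModule

/-! ## The polynomial ring with its fine grading -/

/-- The degree-`a` part of the polynomial ring `S = K[x₁, …, xₙ]` with its `ℤⁿ`-grading, in which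
`xᵢ` has degree `eᵢ`. -/
abbrev polyGrading (K : Type u) [Field K] (n : ℕ) (a : Fin n → ℤ) :
    Submodule K (MvPolynomial (Fin n) K) :=
  MvPolynomial.weightedHomogeneousSubmodule K (fun i => (Pi.single i 1 : Fin n → ℤ)) a

/-- The exponent vector `c ∈ ℕⁿ` regarded as a degree in `ℤⁿ`. -/
def toDeg {n : ℕ} (c : Fin n →₀ ℕ) : Fin n → ℤ := fun i => (c i : ℤ)

/-- The exponent vector `b - a` (truncated at `0`; only used for `a ≤ b`). -/
def expo {n : ℕ} (a b : Fin n → ℤ) : Fin n →₀ ℕ :=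
  Finsupp.equivFunOnFinite.symm (fun i => (b i - a i).toNat)

/-- The monomial `x^c` of `S`. -/
abbrev mono (K : Type u) [Field K] {n : ℕ} (c : Fin n →₀ ℕ) : MvPolynomial (Fin n) K :=
  MvPolynomial.monomial c 1

theorem weight_eq_toDeg {n : ℕ} (c : Fin n →₀ ℕ) :
    Finsupp.weight (fun i => (Pi.single i 1 : Fin n → ℤ)) c = toDeg c := by
  funext j
  rw [Finsupp.weight_apply, Finsupp.sum_fintype _ _ (by simp)]
  simp [toDeg, Finset.sum_apply, Pi.single_apply]

theorem mono_mem (K : Type u) [Field K] {n : ℕ} (c : Fin n →₀ ℕ) :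
    mono K c ∈ polyGrading K n (toDeg c) :=
  MvPolynomial.isWeightedHomogeneous_monomial _ _ _ (weight_eq_toDeg c)

theorem toDeg_expo {n : ℕ} {a b : Fin n → ℤ} (h : a ≤ b) : toDeg (expo a b) = b - a := by
  funext i
  have h1 : a i ≤ b i := h i
  simp only [toDeg, expo, Finsupp.equivFunOnFinite_symm_apply_apply, Pi.sub_apply]
  omega

theorem expo_self {n : ℕ} (a : Fin n → ℤ) : expo a a = 0 := by
  ext i
  simp [expo]

theorem expo_add {n : ℕ} {a b c : Fin n → ℤ} (h : a ≤ b) (h' : b ≤ c) :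
    expo b c + expo a b = expo a c := by
  ext i
  have h1 : a i ≤ b i := h i
  have h2 : b i ≤ c i := h' i
  simp only [expo, Finsupp.add_apply, Finsupp.equivFunOnFinite_symm_apply_apply]
  omega

theorem mono_expo_self (K : Type u) [Field K] {n : ℕ} (a : Fin n → ℤ) :
    mono K (expo a a) = 1 := by
  rw [expo_self]; rfl

theorem mono_expo_mul (K : Type u) [Field K] {n : ℕ} {a b c : Fin n → ℤ} (h : a ≤ b)
    (h' : b ≤ c) : mono K (expo b c) * mono K (expo a b) = mono K (expo a c) := by
  simp [mono, MvPolynomial.monomial_mul, expo_add h h']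

/-! ## The category of `ℤⁿ`-graded `S`-modules -/

/-- A `ℤⁿ`-graded module over `S = K[x₁, …, xₙ]`: an `S`-module that is the internal direct sum of
`K`-subspaces `M_a`, `a ∈ ℤⁿ`, with `S_a M_b ⊆ M_{a+b}`. -/
structure GrMod (K : Type u) [Field K] (n : ℕ) : Type (u + 1) where
  /-- the underlying module -/
  carrier : Type u
  [addCommGroup : AddCommGroup carrier]
  [moduleK : Module K carrier]
  [moduleS : Module (MvPolynomial (Fin n) K) carrier]
  [isScalarTower : IsScalarTower K (MvPolynomial (Fin n) K) carrier]
  /-- the homogeneous components -/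
  grading : (Fin n → ℤ) → Submodule K carrier
  isInternal : DirectSum.IsInternal grading
  smul_mem : ∀ (a b : Fin n → ℤ) (p : MvPolynomial (Fin n) K) (m : carrier),
    p ∈ polyGrading K n a → m ∈ grading b → p • m ∈ grading (a + b)

attribute [instance] GrMod.addCommGroup GrMod.moduleK GrMod.moduleS GrMod.isScalarTower

variable {K : Type u} [Field K] {n : ℕ}

theorem GrMod.mono_expo_smul_mem (M : GrMod K n) {a b : Fin n → ℤ} (h : a ≤ b) {m : M.carrier}
    (hm : m ∈ M.grading a) : mono K (expo a b) • m ∈ M.grading b := by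
  have := M.smul_mem _ _ _ _ (mono_mem K (expo a b)) hm
  rwa [toDeg_expo h, sub_add_cancel] at this

/-- The `K`-space of degree-preserving `S`-linear maps `M → N`. -/
def homs (M N : GrMod K n) : Submodule K (M.carrier →ₗ[MvPolynomial (Fin n) K] N.carrier) where
  carrier := {f | ∀ a, ∀ m ∈ M.grading a, f m ∈ N.grading a}
  add_mem' hf hg a m hm := (N.grading a).add_mem (hf a m hm) (hg a m hm)
  zero_mem' a _ _ := (N.grading a).zero_mem
  smul_mem' c _ hf a m hm := (N.grading a).smul_mem c (hf a m hm)

/-- The category of `ℤⁿ`-graded `S`-modules and degree-preserving `S`-linear maps. -/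
instance : Category (GrMod K n) where
  Hom M N := homs M N
  id M := ⟨LinearMap.id, fun _ _ hm => hm⟩
  comp f g := ⟨g.1.comp f.1, fun a m hm => g.2 a _ (f.2 a m hm)⟩

@[ext]
theorem GrMod.hom_ext {M N : GrMod K n} (f g : M ⟶ N) (h : f.1 = g.1) : f = g :=
  Subtype.ext h

/-! ## Degree shifts -/

theorem isInternal_reindex {V : Type u} [AddCommGroup V] [Module K V]
    (A : (Fin n → ℤ) → Submodule K V) (hA : DirectSum.IsInternal A) (a : Fin n → ℤ) :
    DirectSum.IsInternal (fun b => A (a + b)) := by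
  rw [DirectSum.isInternal_submodule_iff_iSupIndep_and_iSup_eq_top] at hA ⊢
  refine ⟨hA.1.comp (add_right_injective a), ?_⟩
  rw [← hA.2]
  exact (Equiv.addLeft a).iSup_comp (g := A)

/-- The module `M(a)`, with the same underlying `S`-module as `M` and `M(a)_b = M_{a+b}`. -/
def GrMod.twist (M : GrMod K n) (a : Fin n → ℤ) : GrMod K n where
  carrier := M.carrier
  grading b := M.grading (a + b)
  isInternal := isInternal_reindex M.grading M.isInternal a
  smul_mem b c p m hp hm := by
    have := M.smul_mem b (a + c) p m hp hm
    rwa [add_left_comm] at this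

/-- The shift functor `σ_a`, `σ_a(M) = M(-a)`. -/
def shift (a : Fin n → ℤ) : GrMod K n ⥤ GrMod K n where
  obj M := M.twist (-a)
  map f := ⟨f.1, fun b m hm => f.2 (-a + b) m hm⟩

/-! ## Assembling a graded module from its components

A family of `K`-spaces `V_a` with functorial maps `V_a → V_b` for `a ≤ b` defines a `ℤⁿ`-graded
`S`-module `⨁ V_a`, in which `x^c` acts on `V_a` as the given map `V_a → V_{a+c}`. -/

/-- A family of `K`-spaces indexed by `ℤⁿ` with functorial maps `V_a → V_b` for `a ≤ b`. -/
structure Family (K : Type u) [Field K] (n : ℕ) : Type (u + 1) where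
  /-- the components -/
  space : (Fin n → ℤ) → Type u
  [addCommGroup : ∀ a, AddCommGroup (space a)]
  [module : ∀ a, Module K (space a)]
  /-- the transition maps -/
  map : ∀ {a b : Fin n → ℤ}, a ≤ b → space a →ₗ[K] space b
  map_self : ∀ (a : Fin n → ℤ) (v : space a), map (le_refl a) v = v
  map_map : ∀ {a b c : Fin n → ℤ} (h : a ≤ b) (h' : b ≤ c) (v : space a),
    map h' (map h v) = map (h.trans h') v

attribute [instance] Family.addCommGroup Family.module

/-- A morphism of families: linear maps of components commuting with the transition maps. -/
structure FamilyHom (V W : Family K n) : Type u where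
  /-- the component maps -/
  app : ∀ a, V.space a →ₗ[K] W.space a
  naturality : ∀ {a b : Fin n → ℤ} (h : a ≤ b) (v : V.space a),
    app b (V.map h v) = W.map h (app a v)

section Assemble

variable (V : Family K n)

/-- The underlying `K`-space `⨁ V_a`. -/
abbrev Total : Type u := DirectSum (Fin n → ℤ) V.space

/-- The inclusion `V_a → ⨁ V_a`. -/
abbrev incl (a : Fin n → ℤ) : V.space a →ₗ[K] Total V :=
  DirectSum.lof K (Fin n → ℤ) V.space a

theorem incl_congr {a b b' : Fin n → ℤ} (h : a ≤ b) (h' : a ≤ b') (e : b = b') (v : V.space a) :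
    incl V b (V.map h v) = incl V b' (V.map h' v) := by
  subst e
  rfl

theorem le_add_toDeg (a : Fin n → ℤ) (c : Fin n →₀ ℕ) : a ≤ a + toDeg c := by
  intro i
  simp [toDeg]

/-- The action of the monomial `x^c` on `⨁ V_a`. -/
def monoAct (c : Fin n →₀ ℕ) : Module.End K (Total V) :=
  DirectSum.toModule K (Fin n → ℤ) (Total V)
    (fun a => (incl V (a + toDeg c)).comp (V.map (le_add_toDeg a c)))

theorem monoAct_incl (c : Fin n →₀ ℕ) (a : Fin n → ℤ) (v : V.space a) :
    monoAct V c (incl V a v) = incl V (a + toDeg c) (V.map (le_add_toDeg a c) v) := by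
  simp [monoAct, incl, DirectSum.toModule_lof]

theorem monoAct_zero : monoAct V 0 = 1 := by
  refine DirectSum.linearMap_ext K fun a => LinearMap.ext fun v => ?_
  change monoAct V 0 (incl V a v) = incl V a v
  rw [monoAct_incl, incl_congr V _ (le_refl a) (by funext i; simp [toDeg]), V.map_self]

theorem monoAct_add (c d : Fin n →₀ ℕ) : monoAct V (c + d) = monoAct V c * monoAct V d := by
  refine DirectSum.linearMap_ext K fun a => LinearMap.ext fun v => ?_
  change monoAct V (c + d) (incl V a v) = monoAct V c (monoAct V d (incl V a v))
  rw [monoAct_incl, monoAct_incl, monoAct_incl, V.map_map]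
  exact incl_congr V _ _ (by funext i; simp [toDeg]; ring) v

/-- The `K`-algebra map `S → End_K(⨁ V_a)` giving the `S`-module structure. -/
def polyAct : MvPolynomial (Fin n) K →ₐ[K] Module.End K (Total V) :=
  AddMonoidAlgebra.lift K (Module.End K (Total V)) (Fin n →₀ ℕ)
    { toFun := fun c => monoAct V c.toAdd
      map_one' := monoAct_zero V
      map_mul' := fun c d => monoAct_add V c.toAdd d.toAdd }

theorem polyAct_monomial (c : Fin n →₀ ℕ) (r : K) :
    polyAct V (MvPolynomial.monomial c r) = r • monoAct V c :=
  AddMonoidAlgebra.lift_single _ _ _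

theorem isInternal_range_incl :
    DirectSum.IsInternal (fun a => LinearMap.range (incl V a)) := by
  classical
  rw [DirectSum.isInternal_submodule_iff_iSupIndep_and_iSup_eq_top]
  constructor
  · intro a
    rw [Submodule.disjoint_def]
    rintro x ⟨v, rfl⟩ hx
    have hle : (⨆ (b : Fin n → ℤ) (_ : b ≠ a), LinearMap.range (incl V b)) ≤
        LinearMap.ker (DirectSum.component K (Fin n → ℤ) V.space a) := by
      refine iSup₂_le fun b hb => ?_
      rintro _ ⟨w, rfl⟩
      rw [LinearMap.mem_ker, DirectSum.component.of]
      simp [hb]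
    have h0 := hle hx
    rw [LinearMap.mem_ker, DirectSum.component.lof_self] at h0
    rw [h0, map_zero]
  · rw [eq_top_iff]
    intro x _
    induction x using DirectSum.induction_on with
    | zero => exact Submodule.zero_mem _
    | of a v => exact Submodule.mem_iSup_of_mem a ⟨v, rfl⟩
    | add x y hx hy => exact Submodule.add_mem _ (hx trivial) (hy trivial)

/-- The graded module `⨁ V_a`. -/
def assemble : GrMod K n :=
  letI : Module (MvPolynomial (Fin n) K) (Total V) :=
    Module.compHom (Total V) (polyAct V).toRingHom
  { carrier := Total V
    isScalarTower := ⟨fun k p m => by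
      change polyAct V (k • p) m = k • polyAct V p m
      rw [map_smul]; rfl⟩
    grading := fun a => LinearMap.range (incl V a)
    isInternal := isInternal_range_incl V
    smul_mem := by
      rintro a b p _ hp ⟨v, rfl⟩
      change polyAct V p (incl V b v) ∈ _
      rw [p.as_sum, map_sum, LinearMap.sum_apply]
      refine Submodule.sum_mem _ fun c hc => ?_
      have hca : toDeg c = a := by
        rw [← weight_eq_toDeg]
        exact hp (MvPolynomial.mem_support_iff.mp hc)
      rw [polyAct_monomial, LinearMap.smul_apply, monoAct_incl]
      refine Submodule.smul_mem _ _ ?_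
      rw [← hca, add_comm (toDeg c)]
      exact ⟨_, rfl⟩ }

variable {V} {W U : Family K n}

/-- The `K`-linear map `⨁ V_a → ⨁ W_a` with the given components `V_a → W_a`. -/
def assembleMapK (η : FamilyHom V W) : Total V →ₗ[K] Total W :=
  DirectSum.toModule K (Fin n → ℤ) (Total W) (fun a => (incl W a).comp (η.app a))

theorem assembleMapK_incl (η : FamilyHom V W) (a : Fin n → ℤ) (v : V.space a) :
    assembleMapK η (incl V a v) = incl W a (η.app a v) := by
  simp [assembleMapK, incl, DirectSum.toModule_lof]

theorem assembleMapK_monoAct (η : FamilyHom V W) (c : Fin n →₀ ℕ) (m : Total V) :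
    assembleMapK η (monoAct V c m) = monoAct W c (assembleMapK η m) := by
  have : (assembleMapK η).comp (monoAct V c) = (monoAct W c).comp (assembleMapK η) := by
    refine DirectSum.linearMap_ext K fun a => LinearMap.ext fun v => ?_
    change assembleMapK η (monoAct V c (incl V a v)) = monoAct W c (assembleMapK η (incl V a v))
    rw [monoAct_incl, assembleMapK_incl, assembleMapK_incl, monoAct_incl, η.naturality]
  exact LinearMap.congr_fun this m

theorem assembleMapK_polyAct (η : FamilyHom V W) (p : MvPolynomial (Fin n) K) (m : Total V) :
    assembleMapK η (polyAct V p m) = polyAct W p (assembleMapK η m) := by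
  rw [p.as_sum, map_sum, map_sum, LinearMap.sum_apply, LinearMap.sum_apply, map_sum]
  refine Finset.sum_congr rfl fun c _ => ?_
  rw [polyAct_monomial, polyAct_monomial, LinearMap.smul_apply, LinearMap.smul_apply, map_smul,
    assembleMapK_monoAct]

/-- The morphism of graded modules `⨁ V_a → ⨁ W_a` with the given components `V_a → W_a`. -/
def assembleMap (η : FamilyHom V W) : assemble V ⟶ assemble W :=
  ⟨{ toFun := assembleMapK η
     map_add' := map_add (assembleMapK η)
     map_smul' := fun p m => assembleMapK_polyAct η p m },
    by
      rintro a _ ⟨v, rfl⟩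
      exact ⟨_, (assembleMapK_incl η a v).symm⟩⟩

theorem assembleMap_eq_id (η : FamilyHom V V) (h : ∀ a v, η.app a v = v) :
    assembleMap η = 𝟙 (assemble V) := by
  have : assembleMapK η = LinearMap.id := by
    refine DirectSum.linearMap_ext K fun a => LinearMap.ext fun v => ?_
    change assembleMapK η (incl V a v) = incl V a v
    rw [assembleMapK_incl, h]
  exact GrMod.hom_ext _ _ (LinearMap.ext fun m => LinearMap.congr_fun this m)

theorem assembleMap_eq_comp (η : FamilyHom V W) (θ : FamilyHom W U) (ζ : FamilyHom V U)
    (h : ∀ a v, ζ.app a v = θ.app a (η.app a v)) :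
    assembleMap ζ = assembleMap η ≫ assembleMap θ := by
  have : assembleMapK ζ = (assembleMapK θ).comp (assembleMapK η) := by
    refine DirectSum.linearMap_ext K fun a => LinearMap.ext fun v => ?_
    change assembleMapK ζ (incl V a v) = assembleMapK θ (assembleMapK η (incl V a v))
    rw [assembleMapK_incl, assembleMapK_incl, assembleMapK_incl, h]
  exact GrMod.hom_ext _ _ (LinearMap.ext fun m => LinearMap.congr_fun this m)

end Assemble

/-! ## The functor `q^*` -/

/-- The vector of non-negative parts of `a`; it is `a` itself for `a ∈ ℕⁿ`. -/
def toNatVec (a : Fin n → ℤ) : Fin n → ℕ := fun i => (a i).toNat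

theorem toNatVec_mono {a b : Fin n → ℤ} (h : a ≤ b) : toNatVec a ≤ toNatVec b :=
  fun i => Int.toNat_le_toNat (h i)

open Classical in
/-- The component `(q^*M)_a`: it is `M_{q(a)}` for `a ∈ ℕⁿ` and `0` for all other `a ∈ ℤⁿ`. -/
def pullComp (q : (Fin n → ℕ) →o (Fin n → ℤ)) (M : GrMod K n) (a : Fin n → ℤ) :
    Submodule K M.carrier :=
  if 0 ≤ a then M.grading (q (toNatVec a)) else ⊥

theorem pullComp_smul_mem (q : (Fin n → ℕ) →o (Fin n → ℤ)) (M : GrMod K n) {a b : Fin n → ℤ}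
    (h : a ≤ b) {m : M.carrier} (hm : m ∈ pullComp q M a) :
    mono K (expo (q (toNatVec a)) (q (toNatVec b))) • m ∈ pullComp q M b := by
  unfold pullComp at hm ⊢
  by_cases ha : 0 ≤ a
  · rw [if_pos ha] at hm
    rw [if_pos (ha.trans h)]
    exact M.mono_expo_smul_mem (q.monotone (toNatVec_mono h)) hm
  · rw [if_neg ha, Submodule.mem_bot] at hm
    rw [hm, smul_zero]
    exact Submodule.zero_mem _

theorem pullComp_map_mem (q : (Fin n → ℕ) →o (Fin n → ℤ)) {M N : GrMod K n} (f : M ⟶ N)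
    {a : Fin n → ℤ} {m : M.carrier} (hm : m ∈ pullComp q M a) : f.1 m ∈ pullComp q N a := by
  unfold pullComp at hm ⊢
  by_cases ha : 0 ≤ a
  · rw [if_pos ha] at hm ⊢
    exact f.2 _ _ hm
  · rw [if_neg ha, Submodule.mem_bot] at hm
    rw [hm, map_zero]
    exact Submodule.zero_mem _

/-- The components of `q^*M`; the map from degree `a` to degree `b ≥ a` is multiplication by
`x^{q(b) - q(a)}`. -/
def pullData (q : (Fin n → ℕ) →o (Fin n → ℤ)) (M : GrMod K n) : Family K n where
  space a := pullComp q M a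
  map {a b} h :=
    { toFun := fun m => ⟨mono K (expo (q (toNatVec a)) (q (toNatVec b))) • m.1,
        pullComp_smul_mem q M h m.2⟩
      map_add' := fun _ _ => Subtype.ext (smul_add _ _ _)
      map_smul' := fun _ _ => Subtype.ext (smul_comm _ _ _) }
  map_self a m := by
    refine Subtype.ext ?_
    change mono K (expo (q (toNatVec a)) (q (toNatVec a))) • m.1 = m.1
    rw [mono_expo_self, one_smul]
  map_map {a b c} h h' m := by
    refine Subtype.ext ?_
    change mono K (expo (q (toNatVec b)) (q (toNatVec c))) •
          mono K (expo (q (toNatVec a)) (q (toNatVec b))) • m.1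
      = mono K (expo (q (toNatVec a)) (q (toNatVec c))) • m.1
    rw [smul_smul, mono_expo_mul K (q.monotone (toNatVec_mono h))
      (q.monotone (toNatVec_mono h'))]

/-- For an order-preserving map `q : ℕⁿ → ℤⁿ`, the functor `q^*` from `ℤⁿ`-graded modules to
`ℕⁿ`-graded modules (`ℤⁿ`-graded modules that vanish outside `ℕⁿ`): `(q^*M)_a = M_{q(a)}` for
`a ∈ ℕⁿ`, and `x^c : (q^*M)_a → (q^*M)_{a+c}` is multiplication by `x^{q(a+c) - q(a)}`. -/
def pull (q : (Fin n → ℕ) →o (Fin n → ℤ)) : GrMod K n ⥤ GrMod K n where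
  obj M := assemble (pullData q M)
  map f := assembleMap
    { app := fun _ =>
        { toFun := fun m => ⟨f.1 m.1, pullComp_map_mem q f m.2⟩
          map_add' := fun _ _ => Subtype.ext (map_add f.1 _ _)
          map_smul' := fun k m => Subtype.ext (LinearMap.map_smul_of_tower f.1 k m.1) }
      naturality := fun _ m => Subtype.ext (map_smul f.1 _ m.1) }
  map_id _ := assembleMap_eq_id _ fun _ _ => rfl
  map_comp _ _ := assembleMap_eq_comp _ _ _ fun _ _ => rfl

/-! ## The graded Hom -/

theorem GrMod.twist_smul_mem (N : GrMod K n) {a b : Fin n → ℤ} (h : a ≤ b) (c : Fin n → ℤ)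
    {m : N.carrier} (hm : m ∈ N.grading (a + c)) :
    mono K (expo a b) • m ∈ N.grading (b + c) := by
  have := N.smul_mem _ _ _ _ (mono_mem K (expo a b)) hm
  rwa [toDeg_expo h, ← add_assoc, sub_add_cancel] at this

/-- The components `Hom(M, N(a))` of the graded Hom; the map from degree `a` to degree `b ≥ a` is
multiplication by `x^{b-a}`. -/
def grHomData (M N : GrMod K n) : Family K n where
  space a := homs M (N.twist a)
  map {a b} h :=
    { toFun := fun f => ⟨mono K (expo a b) • f.1, fun c m hm =>
        N.twist_smul_mem h c (f.2 c m hm)⟩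
      map_add' := fun _ _ => Subtype.ext (smul_add _ _ _)
      map_smul' := fun k f => Subtype.ext (LinearMap.ext fun m =>
        smul_comm (mono K (expo a b)) k (show N.carrier from f.1 m)) }
  map_self a f := by
    refine Subtype.ext (LinearMap.ext fun m => ?_)
    change mono K (expo a a) • f.1 m = f.1 m
    rw [mono_expo_self, one_smul]
  map_map {a b c} h h' f := by
    refine Subtype.ext (LinearMap.ext fun m => ?_)
    change mono K (expo b c) • mono K (expo a b) • (show N.carrier from f.1 m)
      = mono K (expo a c) • (show N.carrier from f.1 m)
    rw [smul_smul, mono_expo_mul K h h']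

/-- The contravariant functor `*Hom_S(-, N)`, with
`*Hom_S(M, N) = ⨁_{a ∈ ℤⁿ} Hom(M, N(a))`. -/
def grHom (N : GrMod K n) : (GrMod K n)ᵒᵖ ⥤ GrMod K n where
  obj M := assemble (grHomData M.unop N)
  map f := assembleMap
    { app := fun _ =>
        { toFun := fun g => ⟨g.1.comp f.unop.1, fun c m hm => g.2 c _ (f.unop.2 c m hm)⟩
          map_add' := fun _ _ => rfl
          map_smul' := fun _ _ => rfl }
      naturality := fun _ _ => rfl }
  map_id _ := assembleMap_eq_id _ fun _ _ => rfl
  map_comp _ _ := assembleMap_eq_comp _ _ _ fun _ _ => rfl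

/-! ## The modules `S` and `E` -/

variable (K n) in
/-- The polynomial ring `S` as a graded module over itself. -/
def polyModule : GrMod K n where
  carrier := MvPolynomial (Fin n) K
  grading := polyGrading K n
  isInternal :=
    letI := MvPolynomial.weightedGradedAlgebra K (fun i => (Pi.single i 1 : Fin n → ℤ))
    DirectSum.Decomposition.isInternal (polyGrading K n)
  smul_mem _ _ _ _ hp hm := hp.mul hm

open Classical in
/-- The degree-`a` component of `E`: it is `K · x^a` for `a ≤ 0` and `0` otherwise. -/
def hullComp (K : Type u) [Field K] {n : ℕ} (a : Fin n → ℤ) : Submodule K K :=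
  if a ≤ 0 then ⊤ else ⊥

open Classical in
theorem hull_mem {K : Type u} [Field K] {n : ℕ} (b : Fin n → ℤ) (k : K) :
    (if b ≤ 0 then k else 0) ∈ hullComp K b := by
  by_cases h : b ≤ 0
  · rw [hullComp, if_pos h]
    exact Submodule.mem_top
  · rw [if_neg h]
    exact Submodule.zero_mem _

open Classical in
/-- The components of `E = K[x₁⁻¹, …, xₙ⁻¹]`: the map from degree `a` to degree `b ≥ a` sends
`x^a` to `x^b` if `b ≤ 0`, and to `0` otherwise. -/
def hullData (K : Type u) [Field K] (n : ℕ) : Family K n where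
  space a := hullComp K a
  map {a b} _ :=
    { toFun := fun k => ⟨if b ≤ 0 then k.1 else 0, hull_mem b k.1⟩
      map_add' := fun k l => Subtype.ext (by
        change (if b ≤ 0 then k.1 + l.1 else 0)
          = (if b ≤ 0 then k.1 else 0) + (if b ≤ 0 then l.1 else 0)
        by_cases h : b ≤ 0 <;> simp [h])
      map_smul' := fun r k => Subtype.ext (by
        change (if b ≤ 0 then r • k.1 else 0) = r • (if b ≤ 0 then k.1 else 0)
        by_cases h : b ≤ 0 <;> simp [h]) }
  map_self a k := by
    refine Subtype.ext ?_
    change (if a ≤ 0 then k.1 else 0) = k.1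
    by_cases h : a ≤ 0
    · rw [if_pos h]
    · obtain ⟨k, hk⟩ := k
      rw [hullComp, if_neg h, Submodule.mem_bot] at hk
      rw [if_neg h]
      exact hk.symm
  map_map {a b c} _ h' k := by
    refine Subtype.ext ?_
    change (if c ≤ 0 then (if b ≤ 0 then k.1 else 0) else 0) = if c ≤ 0 then k.1 else 0
    by_cases hc : c ≤ 0
    · rw [if_pos hc, if_pos hc, if_pos (h'.trans hc)]
    · rw [if_neg hc, if_neg hc]

/-- The `ℤⁿ`-graded injective hull `E` of `K = S/(x₁, …, xₙ)`, in its standard form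
`K[x₁⁻¹, …, xₙ⁻¹]`: the space with basis `x^a`, `a ≤ 0`, where `x^c · x^a` is `x^{a+c}` if
`a + c ≤ 0`, and `0` otherwise. -/
def injHull (K : Type u) [Field K] (n : ℕ) : GrMod K n := assemble (hullData K n)

/-! ## Positively `t`-determined modules -/

/-- A `ℤⁿ`-graded module `M` is positively `t`-determined if it is finitely generated over `S` and
`ℕⁿ`-graded, and multiplication by `xᵢ` is a bijection `M_a → M_{a+eᵢ}` whenever `aᵢ ≥ tᵢ`. -/
def PosDet (K : Type u) [Field K] {n : ℕ} (t : Fin n → ℕ) : ObjectProperty (GrMod K n) := fun M =>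
  Module.Finite (MvPolynomial (Fin n) K) M.carrier ∧
  (∀ a : Fin n → ℤ, ¬ 0 ≤ a → M.grading a = ⊥) ∧
  ∀ (i : Fin n) (a : Fin n → ℤ), (t i : ℤ) ≤ a i →
    Set.BijOn (fun m : M.carrier => (MvPolynomial.X i : MvPolynomial (Fin n) K) • m)
      (M.grading a) (M.grading (a + Pi.single i 1))

/-! ## The order-preserving maps `r`, `s`, `p_t` -/

/-- `t ∈ ℕⁿ` as a degree in `ℤⁿ`. -/
def natDeg (t : Fin n → ℕ) : Fin n → ℤ := fun i => (t i : ℤ)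

/-- `r(a)ᵢ = tᵢ` if `aᵢ > 0`, and `0` otherwise. -/
def rMap (t : Fin n → ℕ) : (Fin n → ℕ) →o (Fin n → ℤ) where
  toFun a i := if 0 < a i then (t i : ℤ) else 0
  monotone' a b h i := by
    have h1 : a i ≤ b i := h i
    dsimp only
    split_ifs <;> omega

/-- `s(a)ᵢ = tᵢ` if `aᵢ ≥ 1`, and `tᵢ - 1` otherwise. -/
def sMap (t : Fin n → ℕ) : (Fin n → ℕ) →o (Fin n → ℤ) where
  toFun a i := if 1 ≤ a i then (t i : ℤ) else (t i : ℤ) - 1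
  monotone' a b h i := by
    have h1 : a i ≤ b i := h i
    dsimp only
    split_ifs <;> omega

/-- `p_t(a)ᵢ = aᵢ` if `aᵢ < tᵢ`, and `tᵢ` otherwise. -/
def pMap (t : Fin n → ℕ) : (Fin n → ℕ) →o (Fin n → ℤ) where
  toFun a i := if a i < t i then (a i : ℤ) else (t i : ℤ)
  monotone' a b h i := by
    have h1 : a i ≤ b i := h i
    dsimp only
    split_ifs <;> omega

/-! ## The functors `D_t` and `A_t` -/

/-- `D_t(M) = σ_t(*Hom_S(M, S))`, the graded `S`-dual shifted by `t`. -/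
def dualD (K : Type u) [Field K] {n : ℕ} (t : Fin n → ℕ) : (GrMod K n)ᵒᵖ ⥤ GrMod K n :=
  grHom (polyModule K n) ⋙ shift (natDeg t)

/-- The Alexander duality functor `A_t(M) = p_t^* (*Hom_S(M(t), E))`; note `M(t) = σ_{-t}(M)`. -/
def dualA (K : Type u) [Field K] {n : ℕ} (t : Fin n → ℕ) : (GrMod K n)ᵒᵖ ⥤ GrMod K n :=
  (shift (-natDeg t)).op ⋙ grHom (injHull K n) ⋙ pull (pMap t)

/-- The covariant composite `A_t ∘ D_t`. -/
def dualAD (K : Type u) [Field K] {n : ℕ} (t : Fin n → ℕ) : GrMod K n ⥤ GrMod K n :=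
  (dualD K t).rightOp ⋙ dualA K t

end MultigradedModule

end

/-!
Let `B(M) = *Hom_S(*Hom_S(M, S), E)` be the graded bidual. The shifts by `u` in `D_u` and `A_u`
cancel, so `A_u ∘ D_u` is `p_u^* ∘ B` (`dualADIso`). As `c = p_t ∘ c` for `c = p_1` and `c = r`, all
four functors are built from `B` and functors `q^*` alone (`pullCompIso`), and both isomorphisms
take the form

  `p_1^* ∘ B ∘ q^* ≅ c^* ∘ B` on `Mod_t`, with `(q, c) = (r, p_1)` or `(s, r)`.

The components of `B(M)` are made explicit as follows. Evaluation at `(1, …, 1)` is injective on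
each graded piece of `S` and does not see multiplication by monomials. Composition with it
identifies `Hom(M, S(-c))` with the space `functionals M c` of those linear forms on `M` that are
invariant under multiplication by monomials and vanish in all degrees that are not `≥ c`
(`homsPolyEquiv`). By graded Matlis duality (`homsHullEquiv`), `B(M)_c` is the dual of this space
(`bidualEquiv`); multiplication by `x^{b-a}` becomes restriction from `functionals M a` to
`functionals M b`.

If `M` is positively `t`-determined, an invariant linear form on `M` is the same as a linear form on
`M_t` (`PosDet.extend`, `PosDet.functional_ext`), and so is an invariant linear form on `q^*M`,
because `(q^*M)_1 = M_t`. Write `q(a)_i = l_i` when `a_i = 0`. The vanishing conditions for `c(a)`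
on `M` and for `p_1(a)` on `q^*M` both say that the form on `M_t` kills the multiples of elements
whose degree has some `i`-th coordinate at most `l_i` where `a_i ≥ 1`; for this,
`c(a)_i = l_i + 1` when `a_i ≥ 1` is exactly what is needed. Hence `functionals M (c a)` and
`functionals (q^*M) (p_1 a)` correspond (`IsStepPair.functionalsEquiv`), naturally in `M` and
compatibly with the inclusions for varying `a`, and dualizing gives the isomorphism
(`IsStepPair.stepIso`).

The values lie in `Mod_1` because `c` depends only on which coordinates vanish, and because the
components of `B(M)` are finite-dimensional: their preduals embed in the dual of `M_t`
(`posDet_one_pull`, `PosDet.finite_bidual_grading`).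
-/

noncomputable section

universe u

namespace MultigradedModule

variable {K : Type u} [Field K] {n : ℕ}

/-! ### Maps out of a graded module -/

namespace GrMod

/-- The `K`-linear decomposition of a graded module into its homogeneous components. -/
def decomp (M : GrMod K n) : M.carrier ≃ₗ[K] DirectSum (Fin n → ℤ) fun a => M.grading a :=
  (LinearEquiv.ofBijective (DirectSum.coeLinearMap M.grading) M.isInternal).symm

theorem decomp_of_mem (M : GrMod K n) {a : Fin n → ℤ} {m : M.carrier} (hm : m ∈ M.grading a) :
    M.decomp m = DirectSum.lof K (Fin n → ℤ) (fun a => M.grading a) a ⟨m, hm⟩ := by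
  rw [decomp, LinearEquiv.symm_apply_eq]
  exact (DirectSum.coeLinearMap_lof M.grading a ⟨m, hm⟩).symm

/-- The `K`-linear map out of `M` with prescribed restrictions to the homogeneous components. -/
def glue (M : GrMod K n) {V : Type*} [AddCommGroup V] [Module K V]
    (f : ∀ a, M.grading a →ₗ[K] V) : M.carrier →ₗ[K] V :=
  (DirectSum.toModule K _ V f).comp M.decomp.toLinearMap

theorem glue_of_mem (M : GrMod K n) {V : Type*} [AddCommGroup V] [Module K V]
    (f : ∀ a, M.grading a →ₗ[K] V) {a : Fin n → ℤ} {m : M.carrier} (hm : m ∈ M.grading a) :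
    M.glue f m = f a ⟨m, hm⟩ := by
  simp [glue, decomp_of_mem M hm, DirectSum.toModule_lof]

/-- The projection of `M` onto its component of degree `a`. -/
def proj (M : GrMod K n) (a : Fin n → ℤ) : M.carrier →ₗ[K] M.grading a :=
  (DirectSum.component K _ _ a).comp M.decomp.toLinearMap

theorem proj_of_mem (M : GrMod K n) {a : Fin n → ℤ} {m : M.carrier} (hm : m ∈ M.grading a) :
    M.proj a m = ⟨m, hm⟩ := by
  simp [proj, decomp_of_mem M hm, DirectSum.component.lof_self]

theorem proj_of_mem_ne (M : GrMod K n) {a b : Fin n → ℤ} {m : M.carrier} (hm : m ∈ M.grading b)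
    (h : b ≠ a) : M.proj a m = 0 := by
  simp [proj, decomp_of_mem M hm, DirectSum.component.of, h]

theorem iSup_grading (M : GrMod K n) : ⨆ a, M.grading a = ⊤ :=
  ((DirectSum.isInternal_submodule_iff_iSupIndep_and_iSup_eq_top _).1 M.isInternal).2

/-- Induction on the homogeneous elements of a graded module. -/
theorem homogeneous_induction (M : GrMod K n) {P : M.carrier → Prop} (m : M.carrier)
    (hom : ∀ a, ∀ m ∈ M.grading a, P m) (add : ∀ x y, P x → P y → P (x + y)) : P m := by
  have hm : m ∈ ⨆ a, M.grading a := by rw [M.iSup_grading]; trivial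
  refine Submodule.iSup_induction M.grading (motive := P) hm hom ?_ add
  exact hom 0 0 (Submodule.zero_mem _)

theorem linearMap_ext (M : GrMod K n) {V : Type*} [AddCommGroup V] [Module K V]
    {f g : M.carrier →ₗ[K] V} (h : ∀ a, ∀ m ∈ M.grading a, f m = g m) : f = g :=
  LinearMap.ext fun m => M.homogeneous_induction m h fun x y hx hy => by
    rw [map_add, map_add, hx, hy]

theorem hom_ext_of_mem {M N : GrMod K n} {f g : homs M N}
    (h : ∀ a, ∀ m ∈ M.grading a, f.1 m = g.1 m) : f = g :=
  Subtype.ext <| LinearMap.ext fun m => M.homogeneous_induction m h fun x y hx hy => by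
    rw [map_add, map_add, hx, hy]

theorem expo_add_toDeg (a : Fin n → ℤ) (c : Fin n →₀ ℕ) : expo a (a + toDeg c) = c := by
  ext i
  simp [expo, toDeg]

theorem mono_smul_mem (M : GrMod K n) {a : Fin n → ℤ} (c : Fin n →₀ ℕ) {m : M.carrier}
    (hm : m ∈ M.grading a) : mono K c • m ∈ M.grading (a + toDeg c) := by
  rw [add_comm]
  exact M.smul_mem _ _ _ _ (mono_mem K c) hm

theorem monomial_smul (M : GrMod K n) (c : Fin n →₀ ℕ) (r : K) (m : M.carrier) :
    (MvPolynomial.monomial c r : MvPolynomial (Fin n) K) • m = r • mono K c • m := by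
  rw [← smul_assoc, MvPolynomial.smul_monomial, smul_eq_mul, mul_one]

/-- A `K`-linear map that preserves degrees and commutes with the monomials on homogeneous
elements is a morphism of graded modules. -/
def homMk {M N : GrMod K n} (f : M.carrier →ₗ[K] N.carrier)
    (hf : ∀ a, ∀ m ∈ M.grading a, f m ∈ N.grading a)
    (hs : ∀ a b, a ≤ b → ∀ m ∈ M.grading a,
      f (mono K (expo a b) • m) = mono K (expo a b) • f m) : homs M N :=
  ⟨{ toFun := f
     map_add' := map_add f
     map_smul' := fun p m => by
      have key : ∀ c : Fin n →₀ ℕ, ∀ m, f (mono K c • m) = mono K c • f m := by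
        intro c m
        refine M.homogeneous_induction (P := fun m => f (mono K c • m) = mono K c • f m) m
          (fun a m hm => ?_) fun x y hx hy => ?_
        · have := hs a (a + toDeg c) (le_add_toDeg a c) m hm
          rwa [expo_add_toDeg] at this
        · rw [smul_add, map_add, hx, hy, map_add, smul_add]
      change f (p • m) = p • f m
      induction p using MvPolynomial.induction_on' with
      | monomial c r => rw [monomial_smul, map_smul, key, N.monomial_smul c r]
      | add p q hp hq => rw [add_smul, map_add, hp, hq, add_smul] }, hf⟩

theorem comp_apply {M N P : GrMod K n} (f : M ⟶ N) (g : N ⟶ P) (m : M.carrier) :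
    (f ≫ g).1 m = g.1 (f.1 m) := rfl

end GrMod

/-! ### Components of assembled modules -/

/-- The inclusion of the component `V_a` into the graded module `⨁ V_a`. -/
def assembleIncl (V : Family K n) (a : Fin n → ℤ) : V.space a →ₗ[K] (assemble V).carrier :=
  incl V a

theorem assembleIncl_injective (V : Family K n) (a : Fin n → ℤ) :
    Function.Injective (assembleIncl V a) := by
  intro v w h
  exact DirectSum.of_injective (β := V.space) a h

theorem mono_smul_assembleIncl (V : Family K n) {a b : Fin n → ℤ} (h : a ≤ b) (v : V.space a) :
    mono K (expo a b) • assembleIncl V a v = assembleIncl V b (V.map h v) := by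
  change polyAct V (MvPolynomial.monomial (expo a b) 1) (incl V a v) = incl V b (V.map h v)
  rw [polyAct_monomial, one_smul, monoAct_incl]
  exact incl_congr V _ _ (by rw [toDeg_expo h]; abel) v

/-- The component `V_a` is the degree-`a` part of `⨁ V_a`. -/
def assembleEquiv (V : Family K n) (a : Fin n → ℤ) : V.space a ≃ₗ[K] (assemble V).grading a :=
  LinearEquiv.ofInjective (assembleIncl V a) (assembleIncl_injective V a)

theorem assembleIncl_mem (V : Family K n) (a : Fin n → ℤ) (v : V.space a) :
    assembleIncl V a v ∈ (assemble V).grading a := ⟨v, rfl⟩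

theorem assembleMap_assembleIncl {V W : Family K n} (η : FamilyHom V W) (a : Fin n → ℤ)
    (v : V.space a) : (assembleMap η).1 (assembleIncl V a v) = assembleIncl W a (η.app a v) :=
  assembleMapK_incl η a v

/-! ### Homomorphisms into shifts of `S` -/

/-- Evaluation of polynomials at `(1, …, 1)`. On each homogeneous component of `S` it is
injective, and it is invariant under multiplication by monomials. -/
def evalOnes : MvPolynomial (Fin n) K →ₗ[K] K :=
  (MvPolynomial.aeval (fun _ => (1 : K)) : MvPolynomial (Fin n) K →ₐ[K] K).toLinearMap

theorem evalOnes_mono_mul (c : Fin n →₀ ℕ) (p : MvPolynomial (Fin n) K) :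
    evalOnes (mono K c * p) = evalOnes p := by
  change MvPolynomial.aeval (fun _ => (1 : K)) (mono K c * p) =
    MvPolynomial.aeval (fun _ => (1 : K)) p
  rw [map_mul, MvPolynomial.aeval_monomial]
  simp

theorem evalOnes_monomial (c : Fin n →₀ ℕ) (r : K) :
    evalOnes (MvPolynomial.monomial c r : MvPolynomial (Fin n) K) = r := by
  simp [evalOnes, MvPolynomial.aeval_monomial]

theorem eq_monomial_of_mem_polyGrading {a b : Fin n → ℤ} {p : MvPolynomial (Fin n) K}
    (hp : p ∈ polyGrading K n (b - a)) :
    p = MvPolynomial.monomial (expo a b) (evalOnes p) := by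
  have h : p = MvPolynomial.monomial (expo a b) (p.coeff (expo a b)) := by
    ext e
    rw [MvPolynomial.coeff_monomial]
    split_ifs with h
    · rw [h]
    · by_contra h0
      have h1 := hp h0
      rw [weight_eq_toDeg] at h1
      apply h
      ext i
      have := congrFun h1 i
      simp only [toDeg, Pi.sub_apply] at this
      simp only [expo, Finsupp.equivFunOnFinite_symm_apply_apply]
      omega
  have h2 : evalOnes p = p.coeff (expo a b) := by
    conv_lhs => rw [h]
    rw [evalOnes_monomial]
  rw [h2]
  exact h

theorem eq_zero_of_mem_polyGrading {a : Fin n → ℤ} (ha : ¬ 0 ≤ a) {p : MvPolynomial (Fin n) K}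
    (hp : p ∈ polyGrading K n a) : p = 0 := by
  ext e
  rw [MvPolynomial.coeff_zero]
  by_contra h0
  have h1 := hp h0
  rw [weight_eq_toDeg] at h1
  exact ha (h1 ▸ fun i => by simp [toDeg])

theorem monomial_mem_polyGrading {a b : Fin n → ℤ} (h : a ≤ b) (r : K) :
    MvPolynomial.monomial (expo a b) r ∈ polyGrading K n (b - a) :=
  MvPolynomial.isWeightedHomogeneous_monomial _ _ _ (by rw [weight_eq_toDeg, toDeg_expo h])

/-- The `K`-linear functionals on `M` that are invariant under multiplication by monomials and
vanish in all degrees that are not `≥ c`. They are the composites of the morphisms `M → S(-c)`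
with evaluation at `(1, …, 1)`, see `homsPolyEquiv`. -/
def functionals (M : GrMod K n) (c : Fin n → ℤ) : Submodule K (Module.Dual K M.carrier) where
  carrier := {l | (∀ (d : Fin n →₀ ℕ) (m : M.carrier), l (mono K d • m) = l m) ∧
    ∀ a, ¬ c ≤ a → ∀ m ∈ M.grading a, l m = 0}
  add_mem' hl hl' := ⟨fun d m => by simp [hl.1, hl'.1],
    fun a ha m hm => by simp [hl.2 a ha m hm, hl'.2 a ha m hm]⟩
  zero_mem' := ⟨fun _ _ => rfl, fun _ _ _ _ => rfl⟩
  smul_mem' k l hl := ⟨fun d m => by simp [hl.1], fun a ha m hm => by simp [hl.2 a ha m hm]⟩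

theorem mem_functionals {M : GrMod K n} {c : Fin n → ℤ} {l : Module.Dual K M.carrier} :
    l ∈ functionals M c ↔ (∀ (d : Fin n →₀ ℕ) (m : M.carrier), l (mono K d • m) = l m) ∧
      ∀ a, ¬ c ≤ a → ∀ m ∈ M.grading a, l m = 0 := Iff.rfl

theorem functionals_anti (M : GrMod K n) {a b : Fin n → ℤ} (h : a ≤ b) :
    functionals M b ≤ functionals M a := by
  intro l hl
  rw [mem_functionals] at hl ⊢
  exact ⟨hl.1, fun d hd => hl.2 d fun hb => hd (h.trans hb)⟩

/-- The pullback of functionals along a morphism of graded modules. -/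
def functionalsComp {M N : GrMod K n} (f : M ⟶ N) (c : Fin n → ℤ) :
    functionals N c →ₗ[K] functionals M c where
  toFun l := ⟨l.1.comp (f.1.restrictScalars K), by
    have hl := mem_functionals.1 l.2
    refine mem_functionals.2 ⟨fun d m => ?_, fun a ha m hm => hl.2 a ha _ (f.2 a m hm)⟩
    change l.1 (f.1 (mono K d • m)) = l.1 (f.1 m)
    rw [map_smul, hl.1]⟩
  map_add' _ _ := rfl
  map_smul' _ _ := rfl

/-- The `K`-linear map `M → S` sending `m ∈ M_a` to `l(m) x^{a-c}`. The exponent is truncated, but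
`l(m) = 0` unless `c ≤ a`. -/
def functionalMap (M : GrMod K n) (c : Fin n → ℤ) (l : functionals M c) :
    M.carrier →ₗ[K] MvPolynomial (Fin n) K :=
  M.glue fun a => (MvPolynomial.monomial (expo c a)).comp (l.1.comp (M.grading a).subtype)

theorem functionalMap_of_mem (M : GrMod K n) {c : Fin n → ℤ} (l : functionals M c)
    {a : Fin n → ℤ} {m : M.carrier} (hm : m ∈ M.grading a) :
    functionalMap M c l m = MvPolynomial.monomial (expo c a) (l.1 m) :=
  GrMod.glue_of_mem M _ hm

theorem functionalMap_mem (M : GrMod K n) {c : Fin n → ℤ} (l : functionals M c)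
    {a : Fin n → ℤ} {m : M.carrier} (hm : m ∈ M.grading a) :
    functionalMap M c l m ∈ polyGrading K n (-c + a) := by
  rw [functionalMap_of_mem M l hm]
  by_cases h : c ≤ a
  · rw [neg_add_eq_sub]
    exact monomial_mem_polyGrading h _
  · rw [l.2.2 a h m hm, map_zero]
    exact Submodule.zero_mem _

theorem functionalMap_mono_smul (M : GrMod K n) {c : Fin n → ℤ} (l : functionals M c)
    {a b : Fin n → ℤ} (hab : a ≤ b) {m : M.carrier} (hm : m ∈ M.grading a) :
    functionalMap M c l (mono K (expo a b) • m) = mono K (expo a b) * functionalMap M c l m := by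
  rw [functionalMap_of_mem M l hm, functionalMap_of_mem M l (M.mono_expo_smul_mem hab hm), l.2.1,
    MvPolynomial.monomial_mul, one_mul]
  by_cases h : c ≤ a
  · rw [expo_add h hab]
  · rw [l.2.2 a h m hm, map_zero, map_zero]

/-- The morphism `M → S(-c)` that corresponds to a functional. -/
def functionalHom (M : GrMod K n) (c : Fin n → ℤ) (l : functionals M c) :
    homs M ((polyModule K n).twist (-c)) :=
  GrMod.homMk (N := (polyModule K n).twist (-c)) (functionalMap M c l)
    (fun _ _ hm => functionalMap_mem M l hm)
    (fun _ _ hab _ hm => functionalMap_mono_smul M l hab hm)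

theorem functionalHom_of_mem (M : GrMod K n) {c : Fin n → ℤ} (l : functionals M c)
    {a : Fin n → ℤ} {m : M.carrier} (hm : m ∈ M.grading a) :
    (functionalHom M c l).1 m = MvPolynomial.monomial (expo c a) (l.1 m) :=
  functionalMap_of_mem M l hm

/-- Morphisms `M → S(-c)` are determined by their composites with evaluation at `(1, …, 1)`. -/
def homsPolyEquiv (M : GrMod K n) (c : Fin n → ℤ) :
    homs M ((polyModule K n).twist (-c)) ≃ₗ[K] functionals M c where
  toFun φ := ⟨evalOnes.comp
      (show M.carrier →ₗ[K] MvPolynomial (Fin n) K from φ.1.restrictScalars K), by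
    refine mem_functionals.2 ⟨fun d m => ?_, fun a ha m hm => ?_⟩
    · change evalOnes (φ.1 (mono K d • m)) = evalOnes (φ.1 m)
      rw [map_smul]
      exact evalOnes_mono_mul _ _
    · have h := eq_zero_of_mem_polyGrading (fun h => ha (by simpa using h)) (φ.2 a m hm)
      change evalOnes (φ.1 m) = 0
      exact (congrArg evalOnes h).trans (map_zero _)⟩
  map_add' φ ψ := Subtype.ext <| LinearMap.ext fun m => by
    exact map_add (evalOnes (K := K) (n := n)) (φ.1 m) (ψ.1 m)
  map_smul' k φ := Subtype.ext <| LinearMap.ext fun m => by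
    exact map_smul (evalOnes (K := K) (n := n)) k (φ.1 m)
  invFun := functionalHom M c
  left_inv φ := GrMod.hom_ext_of_mem fun a m hm => by
    rw [functionalHom_of_mem M _ hm]
    have h : φ.1 m ∈ polyGrading K n (-c + a) := φ.2 a m hm
    rw [neg_add_eq_sub] at h
    exact (eq_monomial_of_mem_polyGrading h).symm
  right_inv l := Subtype.ext <| M.linearMap_ext fun a m hm => by
    change evalOnes ((functionalHom M c l).1 m) = l.1 m
    rw [functionalHom_of_mem M _ hm]
    exact evalOnes_monomial _ _

theorem homsPolyEquiv_apply (M : GrMod K n) (c : Fin n → ℤ)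
    (φ : homs M ((polyModule K n).twist (-c))) (m : M.carrier) :
    (homsPolyEquiv M c φ).1 m = evalOnes (φ.1 m) := rfl

/-! ### Homomorphisms into shifts of `E` -/

/-- The inclusion of the component of degree `d` into `E`. -/
def hullIncl (K : Type u) [Field K] {n : ℕ} (d : Fin n → ℤ) :
    hullComp K d →ₗ[K] (injHull K n).carrier :=
  assembleIncl (hullData K n) d

theorem mono_smul_hullIncl {a b : Fin n → ℤ} (h : a ≤ b) (k : hullComp K a) :
    mono K (expo a b) • hullIncl K a k =
      hullIncl K b ⟨open Classical in if b ≤ 0 then k.1 else 0, hull_mem b k.1⟩ :=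
  mono_smul_assembleIncl (hullData K n) h k

/-- The element `x^d` of `E`, which is `0` unless `d ≤ 0`. -/
def hullMono (K : Type u) [Field K] {n : ℕ} (d : Fin n → ℤ) : (injHull K n).carrier :=
  hullIncl K d ⟨open Classical in if d ≤ 0 then 1 else 0, hull_mem d 1⟩

theorem hullMono_mem (d : Fin n → ℤ) : hullMono K d ∈ (injHull K n).grading d :=
  assembleIncl_mem _ _ _

theorem hullMono_eq_zero {d : Fin n → ℤ} (h : ¬ d ≤ 0) : hullMono K d = 0 := by
  rw [hullMono, ← map_zero (hullIncl K d)]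
  congr 1
  exact Subtype.ext (if_neg h)

theorem mono_smul_hullMono {a b : Fin n → ℤ} (h : a ≤ b) :
    mono K (expo a b) • hullMono K a = hullMono K b := by
  rw [hullMono, mono_smul_hullIncl h, hullMono]
  congr 1
  refine Subtype.ext ?_
  by_cases hb : b ≤ 0
  · simp [hb, h.trans hb]
  · simp [hb]

/-- The coefficient of `x^0` in an element of `E`. -/
def residue (K : Type u) [Field K] (n : ℕ) : (injHull K n).carrier →ₗ[K] K :=
  (hullComp K (0 : Fin n → ℤ)).subtype.comp
    (DirectSum.component K (Fin n → ℤ) (hullData K n).space 0)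

theorem residue_hullIncl (k : hullComp K (0 : Fin n → ℤ)) :
    residue K n (hullIncl K 0 k) = k.1 :=
  congrArg Subtype.val
    (DirectSum.component.lof_self K (M := (hullData K n).space) (0 : Fin n → ℤ) k)

theorem residue_hullMono_zero : residue K n (hullMono K 0) = 1 := by
  rw [hullMono, residue_hullIncl]
  exact if_pos le_rfl

theorem eq_residue_smul_hullMono {d : Fin n → ℤ} {e : (injHull K n).carrier}
    (he : e ∈ (injHull K n).grading d) :
    e = residue K n (mono K (expo d 0) • e) • hullMono K d := by
  obtain ⟨⟨k, hk⟩, rfl⟩ := he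
  change hullIncl K d ⟨k, hk⟩ =
    residue K n (mono K (expo d 0) • hullIncl K d ⟨k, hk⟩) • hullMono K d
  by_cases hd : d ≤ 0
  · rw [mono_smul_hullIncl hd, residue_hullIncl, hullMono, ← map_smul]
    congr 1
    exact Subtype.ext (by simp [hd])
  · rw [hullMono_eq_zero hd, smul_zero, ← map_zero (hullIncl K d)]
    congr 1
    refine Subtype.ext ?_
    rw [hullComp, if_neg hd, Submodule.mem_bot] at hk
    exact hk

/-- The `K`-linear map `H → E` sending `h ∈ H_b` to `ψ(x^{-c-b} h) x^{c+b}`, which is `0` unless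
`b ≤ -c`. -/
def hullMap (H : GrMod K n) (c : Fin n → ℤ) (ψ : Module.Dual K (H.grading (-c))) :
    H.carrier →ₗ[K] (injHull K n).carrier :=
  H.glue fun b => LinearMap.toSpanSingleton K _ (hullMono K (c + b)) ∘ₗ ψ ∘ₗ H.proj (-c) ∘ₗ
    (LinearMap.lsmul (MvPolynomial (Fin n) K) H.carrier
      (mono K (expo b (-c)))).restrictScalars K ∘ₗ (H.grading b).subtype

theorem hullMap_of_mem (H : GrMod K n) {c : Fin n → ℤ} (ψ : Module.Dual K (H.grading (-c)))
    {b : Fin n → ℤ} {h : H.carrier} (hb : h ∈ H.grading b) :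
    hullMap H c ψ h = ψ (H.proj (-c) (mono K (expo b (-c)) • h)) • hullMono K (c + b) :=
  GrMod.glue_of_mem H _ hb

theorem hullMap_mono_smul (H : GrMod K n) {c : Fin n → ℤ} (ψ : Module.Dual K (H.grading (-c)))
    {a b : Fin n → ℤ} (hab : a ≤ b) {m : H.carrier} (hm : m ∈ H.grading a) :
    hullMap H c ψ (mono K (expo a b) • m) = mono K (expo a b) • hullMap H c ψ m := by
  rw [hullMap_of_mem H ψ hm, hullMap_of_mem H ψ (H.mono_expo_smul_mem hab hm)]
  have h1 : expo a b = expo (c + a) (c + b) := by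
    ext i
    simp [expo]
  rw [smul_comm (mono K (expo a b)), h1, mono_smul_hullMono (add_le_add_right hab c), ← h1]
  by_cases hb : c + b ≤ 0
  · rw [smul_smul (mono K _) (mono K _),
      mono_expo_mul K hab (by simpa [le_neg_iff_add_nonpos_left] using hb)]
  · rw [hullMono_eq_zero hb, smul_zero, smul_zero]

/-- The morphism `H → E(c)` that corresponds to a functional on `H_{-c}`. -/
def hullHom (H : GrMod K n) (c : Fin n → ℤ) (ψ : Module.Dual K (H.grading (-c))) :
    homs H ((injHull K n).twist c) :=
  GrMod.homMk (N := (injHull K n).twist c) (hullMap H c ψ)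
    (fun a _ hm => (hullMap_of_mem H ψ hm).symm ▸ Submodule.smul_mem _ _ (hullMono_mem (c + a)))
    (fun _ _ hab _ hm => hullMap_mono_smul H ψ hab hm)

theorem hullHom_of_mem (H : GrMod K n) {c : Fin n → ℤ} (ψ : Module.Dual K (H.grading (-c)))
    {b : Fin n → ℤ} {h : H.carrier} (hb : h ∈ H.grading b) :
    (hullHom H c ψ).1 h =
      (ψ (H.proj (-c) (mono K (expo b (-c)) • h)) • hullMono K (c + b) : (injHull K n).carrier) :=
  hullMap_of_mem H ψ hb

/-- The graded Matlis duality: `Hom(H, E(c))` is dual to `H_{-c}`. -/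
def homsHullEquiv (H : GrMod K n) (c : Fin n → ℤ) :
    homs H ((injHull K n).twist c) ≃ₗ[K] Module.Dual K (H.grading (-c)) where
  toFun f := residue K n ∘ₗ
    (show H.carrier →ₗ[K] (injHull K n).carrier from f.1.restrictScalars K) ∘ₗ
      (H.grading (-c)).subtype
  map_add' f g := LinearMap.ext fun h => by
    exact map_add (residue K n) (f.1 h.1) (g.1 h.1)
  map_smul' k f := LinearMap.ext fun h => by
    exact map_smul (residue K n) k (f.1 h.1)
  invFun := hullHom H c
  left_inv f := GrMod.hom_ext_of_mem fun b h hb => by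
    rw [hullHom_of_mem H _ hb]
    have h1 : f.1 h ∈ (injHull K n).grading (c + b) := f.2 b h hb
    refine Eq.trans ?_ (eq_residue_smul_hullMono h1).symm
    by_cases hcb : c + b ≤ 0
    · have hbc : b ≤ -c := by simpa [le_neg_iff_add_nonpos_left] using hcb
      rw [GrMod.proj_of_mem _ (H.mono_expo_smul_mem hbc hb)]
      congr 1
      change residue K n (f.1 (mono K (expo b (-c)) • h)) = _
      rw [map_smul]
      have h2 : expo b (-c) = expo (c + b) 0 := by
        ext i
        simp [expo, sub_eq_add_neg, add_comm]
      rw [h2]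
      rfl
    · rw [hullMono_eq_zero hcb, smul_zero, smul_zero]
  right_inv ψ := LinearMap.ext fun h => by
    change residue K n ((hullHom H c ψ).1 h.1) = ψ h
    rw [hullHom_of_mem H ψ h.2, mono_expo_self, one_smul, GrMod.proj_of_mem _ h.2, map_smul,
      add_neg_cancel, residue_hullMono_zero, smul_eq_mul, mul_one]

/-! ### The graded bidual -/

/-- The inclusion of `Hom(M, N(c))` into `*Hom_S(M, N)`. -/
def grHomIncl (M N : GrMod K n) (c : Fin n → ℤ) :
    homs M (N.twist c) →ₗ[K] ((grHom N).obj (Opposite.op M)).carrier :=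
  assembleIncl (grHomData M N) c

theorem grHomIncl_mem (M N : GrMod K n) (c : Fin n → ℤ) (f : homs M (N.twist c)) :
    grHomIncl M N c f ∈ ((grHom N).obj (Opposite.op M)).grading c := ⟨f, rfl⟩

/-- `Hom(M, N(c))` is the component of degree `c` of `*Hom_S(M, N)`. -/
def grHomEquiv (M N : GrMod K n) (c : Fin n → ℤ) :
    homs M (N.twist c) ≃ₗ[K] ((grHom N).obj (Opposite.op M)).grading c :=
  assembleEquiv (grHomData M N) c

/-- Multiplication of a morphism `M → N(a)` by `x^{b-a}`. -/
def homsMonoSmul {M N : GrMod K n} {a b : Fin n → ℤ} (h : a ≤ b) (f : homs M (N.twist a)) :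
    homs M (N.twist b) := (grHomData M N).map h f

theorem homsMonoSmul_apply {M N : GrMod K n} {a b : Fin n → ℤ} (h : a ≤ b)
    (f : homs M (N.twist a)) (m : M.carrier) :
    (homsMonoSmul h f).1 m = mono K (expo a b) • (show N.carrier from f.1 m) := rfl

theorem mono_smul_grHomIncl {M N : GrMod K n} {a b : Fin n → ℤ} (h : a ≤ b)
    (f : homs M (N.twist a)) :
    mono K (expo a b) • grHomIncl M N a f = grHomIncl M N b (homsMonoSmul h f) :=
  mono_smul_assembleIncl (grHomData M N) h f

/-- Precomposition of a morphism `M' → P` with `f`. -/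
def homsPrecomp {M M' P : GrMod K n} (f : M ⟶ M') (g : homs M' P) : homs M P :=
  ⟨g.1.comp f.1, fun a m hm => g.2 a _ (f.2 a m hm)⟩

theorem homsPrecomp_apply {M M' P : GrMod K n} (f : M ⟶ M') (g : homs M' P) (m : M.carrier) :
    (homsPrecomp f g).1 m = g.1 (f.1 m) := rfl

theorem grHom_map_grHomIncl {M M' : GrMod K n} (N : GrMod K n) (f : M ⟶ M') (c : Fin n → ℤ)
    (g : homs M' (N.twist c)) :
    ((grHom N).map f.op).1 (grHomIncl M' N c g) = grHomIncl M N c (homsPrecomp f g) := by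
  unfold grHomIncl
  exact assembleMap_assembleIncl (V := grHomData M' N) (W := grHomData M N) _ c g

/-- The functor `M ↦ *Hom_S(*Hom_S(M, S), E)`. -/
def bidual (K : Type u) [Field K] (n : ℕ) : GrMod K n ⥤ GrMod K n :=
  (grHom (polyModule K n)).rightOp ⋙ grHom (injHull K n)

/-- The graded dual `*Hom_S(M, S)`. -/
abbrev polyDual (M : GrMod K n) : GrMod K n := (grHom (polyModule K n)).obj (Opposite.op M)

/-- The component of degree `c` of the bidual of `M` is dual to the space `functionals M c`. -/
def bidualEquiv (M : GrMod K n) (c : Fin n → ℤ) :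
    ((bidual K n).obj M).grading c ≃ₗ[K] Module.Dual K (functionals M c) :=
  (grHomEquiv (polyDual M) (injHull K n) c).symm ≪≫ₗ
    homsHullEquiv (polyDual M) c ≪≫ₗ
    ((homsPolyEquiv M c).symm ≪≫ₗ grHomEquiv M (polyModule K n) (-c)).dualMap

theorem bidualEquiv_grHomEquiv (M : GrMod K n) (c : Fin n → ℤ)
    (f : homs (polyDual M) ((injHull K n).twist c)) (l : functionals M c) :
    bidualEquiv M c (grHomEquiv (polyDual M) (injHull K n) c f) l =
      residue K n (f.1 (grHomIncl M (polyModule K n) (-c) ((homsPolyEquiv M c).symm l))) := by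
  have h : bidualEquiv M c (grHomEquiv (polyDual M) (injHull K n) c f) =
      ((homsPolyEquiv M c).symm ≪≫ₗ grHomEquiv M (polyModule K n) (-c)).dualMap
        (homsHullEquiv (polyDual M) c f) :=
    congrArg (fun g => ((homsPolyEquiv M c).symm ≪≫ₗ
      grHomEquiv M (polyModule K n) (-c)).dualMap (homsHullEquiv (polyDual M) c g))
      ((grHomEquiv (polyDual M) (injHull K n) c).symm_apply_apply f)
  rw [h]
  rfl

/-- Under `bidualEquiv`, multiplication by `x^{b-a}` on the bidual becomes the restriction of
linear forms from `functionals M a` to the subspace `functionals M b`. -/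
theorem bidualEquiv_mono_smul (M : GrMod K n) {a b : Fin n → ℤ} (h : a ≤ b)
    (y : ((bidual K n).obj M).grading a) (l : functionals M b) :
    bidualEquiv M b ⟨mono K (expo a b) • y.1, GrMod.mono_expo_smul_mem _ h y.2⟩ l =
      bidualEquiv M a y ⟨l.1, functionals_anti M h l.2⟩ := by
  obtain ⟨f, rfl⟩ := (grHomEquiv (polyDual M) (injHull K n) a).surjective y
  have e1 : (⟨mono K (expo a b) • grHomIncl (polyDual M) (injHull K n) a f,
      GrMod.mono_expo_smul_mem _ h (grHomIncl_mem _ _ _ f)⟩ : ((bidual K n).obj M).grading b) =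
      grHomEquiv (polyDual M) (injHull K n) b (homsMonoSmul h f) :=
    Subtype.ext (mono_smul_grHomIncl h f)
  refine (congrArg (fun z => bidualEquiv M b z l) e1).trans ?_
  refine (bidualEquiv_grHomEquiv M b _ l).trans ?_
  refine Eq.trans ?_ (bidualEquiv_grHomEquiv M a f _).symm
  refine congrArg (residue K n) ?_
  rw [homsMonoSmul_apply]
  refine (map_smul f.1 (mono K (expo a b)) _).symm.trans (congrArg f.1 ?_)
  have e2 : expo a b = expo (-b) (-a) := by
    ext i
    simp [expo, sub_eq_add_neg, add_comm]
  rw [e2, mono_smul_grHomIncl (neg_le_neg h)]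
  refine congrArg _ ?_
  rw [LinearEquiv.eq_symm_apply]
  refine Subtype.ext (LinearMap.ext fun m => ?_)
  rw [homsPolyEquiv_apply, homsMonoSmul_apply]
  refine (evalOnes_mono_mul _ _).trans ?_
  rw [← homsPolyEquiv_apply, LinearEquiv.apply_symm_apply]

/-- Under `bidualEquiv`, the morphism of biduals induced by `f` becomes the transpose of the
pullback of functionals along `f`. -/
theorem bidualEquiv_map {M N : GrMod K n} (f : M ⟶ N) {c : Fin n → ℤ}
    (y : ((bidual K n).obj M).grading c) (l : functionals N c) :
    bidualEquiv N c ⟨((bidual K n).map f).1 y.1, ((bidual K n).map f).2 c _ y.2⟩ l =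
      bidualEquiv M c y (functionalsComp f c l) := by
  obtain ⟨g, rfl⟩ := (grHomEquiv (polyDual M) (injHull K n) c).surjective y
  have e1 : (⟨((bidual K n).map f).1 (grHomIncl (polyDual M) (injHull K n) c g),
      ((bidual K n).map f).2 c _ (grHomIncl_mem _ _ _ g)⟩ : ((bidual K n).obj N).grading c) =
      grHomEquiv (polyDual N) (injHull K n) c
        (homsPrecomp ((grHom (polyModule K n)).map f.op) g) :=
    Subtype.ext (grHom_map_grHomIncl (injHull K n) ((grHom (polyModule K n)).map f.op) c g)
  refine (congrArg (fun z => bidualEquiv N c z l) e1).trans ?_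
  refine (bidualEquiv_grHomEquiv N c _ l).trans ?_
  refine Eq.trans ?_ (bidualEquiv_grHomEquiv M c g _).symm
  refine congrArg (residue K n) ?_
  rw [homsPrecomp_apply]
  refine congrArg g.1 ?_
  rw [grHom_map_grHomIncl]
  refine congrArg _ ?_
  rw [LinearEquiv.eq_symm_apply]
  refine Subtype.ext (LinearMap.ext fun m => ?_)
  rw [homsPolyEquiv_apply, homsPrecomp_apply]
  refine (homsPolyEquiv_apply N c _ _).symm.trans ?_
  rw [LinearEquiv.apply_symm_apply]
  rfl

/-! ### The functors `q^*` -/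

theorem natDeg_toNatVec {d : Fin n → ℤ} (hd : 0 ≤ d) : natDeg (toNatVec d) = d := by
  funext i
  exact Int.toNat_of_nonneg (hd i)

theorem natDeg_nonneg (a : Fin n → ℕ) : 0 ≤ natDeg a := fun i => Int.natCast_nonneg (a i)

theorem natDeg_mono {a b : Fin n → ℕ} (h : a ≤ b) : natDeg a ≤ natDeg b :=
  fun i => Int.ofNat_le.2 (h i)

theorem pullComp_of_nonneg (q : (Fin n → ℕ) →o (Fin n → ℤ)) (X : GrMod K n) {d : Fin n → ℤ}
    (hd : 0 ≤ d) : pullComp q X d = X.grading (q (toNatVec d)) :=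
  if_pos hd

theorem pullComp_natDeg (q : (Fin n → ℕ) →o (Fin n → ℤ)) (X : GrMod K n) (a : Fin n → ℕ) :
    pullComp q X (natDeg a) = X.grading (q a) :=
  if_pos (natDeg_nonneg a)

theorem pullComp_of_not_nonneg (q : (Fin n → ℕ) →o (Fin n → ℤ)) (X : GrMod K n) {d : Fin n → ℤ}
    (hd : ¬ 0 ≤ d) : pullComp q X d = ⊥ :=
  if_neg hd

section Pull

variable (q : (Fin n → ℕ) →o (Fin n → ℤ)) (X : GrMod K n)

/-- The identification of `X_{q(a)}` with the component of degree `a ∈ ℕⁿ` of `q^*X`. -/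
def pullEquiv (a : Fin n → ℕ) :
    X.grading (q a) ≃ₗ[K] ((pull q).obj X).grading (natDeg a) :=
  (LinearEquiv.ofEq _ _ (pullComp_natDeg q X a).symm) ≪≫ₗ assembleEquiv (pullData q X) (natDeg a)

/-- The inclusion of `X_{q(a)}`, `a ∈ ℕⁿ`, into `q^*X`. -/
def pullIncl (a : Fin n → ℕ) : X.grading (q a) →ₗ[K] ((pull q).obj X).carrier :=
  (((pull q).obj X).grading (natDeg a)).subtype ∘ₗ (pullEquiv q X a).toLinearMap

theorem coe_pullEquiv (a : Fin n → ℕ) (m : X.grading (q a)) :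
    (pullEquiv q X a m : ((pull q).obj X).carrier) = pullIncl q X a m := rfl

theorem pullIncl_mem (a : Fin n → ℕ) (m : X.grading (q a)) :
    pullIncl q X a m ∈ ((pull q).obj X).grading (natDeg a) :=
  (pullEquiv q X a m).2

theorem exists_pullIncl {a : Fin n → ℕ} {y : ((pull q).obj X).carrier}
    (hy : y ∈ ((pull q).obj X).grading (natDeg a)) : ∃ m, pullIncl q X a m = y :=
  ⟨(pullEquiv q X a).symm ⟨y, hy⟩, by rw [← coe_pullEquiv, LinearEquiv.apply_symm_apply]⟩

theorem pull_grading_eq_bot {d : Fin n → ℤ} (hd : ¬ 0 ≤ d) :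
    ((pull q).obj X).grading d = ⊥ := by
  rw [eq_bot_iff]
  rintro _ ⟨⟨v, hv⟩, rfl⟩
  rw [pullComp_of_not_nonneg q X hd, Submodule.mem_bot] at hv
  subst hv
  exact map_zero (assembleIncl (pullData q X) d)

theorem mono_smul_pullIncl {a b : Fin n → ℕ} (h : a ≤ b) (m : X.grading (q a)) :
    mono K (expo (natDeg a) (natDeg b)) • pullIncl q X a m =
      pullIncl q X b ⟨mono K (expo (q a) (q b)) • m.1,
        X.mono_expo_smul_mem (q.monotone h) m.2⟩ :=
  mono_smul_assembleIncl (pullData q X) (natDeg_mono h) _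

theorem pull_map_pullIncl {X Y : GrMod K n} (f : X ⟶ Y) (a : Fin n → ℕ) (m : X.grading (q a)) :
    ((pull q).map f).1 (pullIncl q X a m) = pullIncl q Y a ⟨f.1 m.1, f.2 _ _ m.2⟩ :=
  assembleMap_assembleIncl (V := pullData q X) (W := pullData q Y) _ (natDeg a) _

variable {q X}

theorem pull_induction {P : ((pull q).obj X).carrier → Prop} (y : ((pull q).obj X).carrier)
    (incl : ∀ a m, P (pullIncl q X a m)) (add : ∀ x y, P x → P y → P (x + y)) : P y := by
  refine GrMod.homogeneous_induction _ y (fun d y hy => ?_) add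
  by_cases hd : 0 ≤ d
  · rw [← natDeg_toNatVec hd] at hy
    obtain ⟨m, rfl⟩ := exists_pullIncl q X hy
    exact incl _ m
  · rw [pull_grading_eq_bot q X hd, Submodule.mem_bot] at hy
    rw [hy, ← map_zero (pullIncl q X 0)]
    exact incl _ _

theorem pull_hom_ext {Z : GrMod K n} {f g : (pull q).obj X ⟶ Z}
    (h : ∀ a m, f.1 (pullIncl q X a m) = g.1 (pullIncl q X a m)) : f = g :=
  Subtype.ext <| LinearMap.ext fun y => pull_induction (P := fun y => f.1 y = g.1 y) y h
    fun x y hx hy => by rw [map_add, map_add, hx, hy]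

variable (q X)

theorem pullIncl_injective (a : Fin n → ℕ) : Function.Injective (pullIncl q X a) :=
  fun _ _ h => (pullEquiv q X a).injective (Subtype.ext h)

variable {q X} {q' : (Fin n → ℕ) →o (Fin n → ℤ)} {Y : GrMod K n}

open Classical in
/-- The components of the morphism `pullHom`. -/
def pullHomApp (e : ∀ a, X.grading (q a) →ₗ[K] Y.grading (q' a)) (d : Fin n → ℤ) :
    pullComp q X d →ₗ[K] pullComp q' Y d :=
  if h : 0 ≤ d then
    (LinearEquiv.ofEq _ _ (pullComp_of_nonneg q' Y h).symm).toLinearMap ∘ₗ e (toNatVec d) ∘ₗ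
      (LinearEquiv.ofEq _ _ (pullComp_of_nonneg q X h)).toLinearMap
  else 0

theorem pullHomApp_of_nonneg (e : ∀ a, X.grading (q a) →ₗ[K] Y.grading (q' a)) {d : Fin n → ℤ}
    (hd : 0 ≤ d) (v : pullComp q X d) :
    (pullHomApp e d v : Y.carrier) =
      e (toNatVec d) ⟨v.1, by rw [← pullComp_of_nonneg q X hd]; exact v.2⟩ := by
  rw [pullHomApp, dif_pos hd]
  rfl

/-- The morphism of families underlying `pullHom`. -/
def pullFamilyHom (e : ∀ a, X.grading (q a) →ₗ[K] Y.grading (q' a))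
    (he : ∀ a b (h : a ≤ b) m, (e b ⟨mono K (expo (q a) (q b)) • m.1,
      X.mono_expo_smul_mem (q.monotone h) m.2⟩ : Y.carrier) =
        mono K (expo (q' a) (q' b)) • (e a m).1) :
    FamilyHom (pullData q X) (pullData q' Y) where
  app := pullHomApp e
  naturality {a b} h v := by
    by_cases ha : 0 ≤ a
    · refine Subtype.ext ?_
      refine (pullHomApp_of_nonneg e (ha.trans h) _).trans ?_
      refine (he _ _ (toNatVec_mono h)
        ⟨v.1, by rw [← pullComp_of_nonneg q X ha]; exact v.2⟩).trans ?_
      exact congrArg _ (pullHomApp_of_nonneg e ha v).symm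
    · have hv : v = 0 := by
        obtain ⟨v, hv⟩ := v
        rw [pullComp_of_not_nonneg q X ha, Submodule.mem_bot] at hv
        exact Subtype.ext hv
      rw [hv, map_zero]
      exact (map_zero (pullHomApp e b)).trans
        ((congrArg _ (map_zero (pullHomApp e a))).trans (map_zero ((pullData q' Y).map h))).symm

/-- The morphism `q^*X → q'^*Y` with prescribed components `X_{q(a)} → Y_{q'(a)}`. -/
def pullHom (e : ∀ a, X.grading (q a) →ₗ[K] Y.grading (q' a))
    (he : ∀ a b (h : a ≤ b) m, (e b ⟨mono K (expo (q a) (q b)) • m.1,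
      X.mono_expo_smul_mem (q.monotone h) m.2⟩ : Y.carrier) =
        mono K (expo (q' a) (q' b)) • (e a m).1) :
    (pull q).obj X ⟶ (pull q').obj Y :=
  assembleMap (pullFamilyHom e he)

theorem pullHom_pullIncl (e : ∀ a, X.grading (q a) →ₗ[K] Y.grading (q' a)) (he) (a : Fin n → ℕ)
    (m : X.grading (q a)) :
    (pullHom e he).1 (pullIncl q X a m) = pullIncl q' Y a (e a m) := by
  refine (assembleMap_assembleIncl (pullFamilyHom e he) (natDeg a) _).trans ?_
  refine congrArg (assembleIncl (pullData q' Y) (natDeg a)) (Subtype.ext ?_)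
  exact pullHomApp_of_nonneg e (natDeg_nonneg a) _

/-- An isomorphism `q^*X ≅ q'^*Y` from isomorphisms of components `X_{q(a)} ≃ Y_{q'(a)}`. -/
def pullIso (e : ∀ a, X.grading (q a) ≃ₗ[K] Y.grading (q' a))
    (he : ∀ a b (h : a ≤ b) m, (e b ⟨mono K (expo (q a) (q b)) • m.1,
      X.mono_expo_smul_mem (q.monotone h) m.2⟩ : Y.carrier) =
        mono K (expo (q' a) (q' b)) • (e a m).1) :
    (pull q).obj X ≅ (pull q').obj Y where
  hom := pullHom (fun a => (e a).toLinearMap) he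
  inv := pullHom (fun a => (e a).symm.toLinearMap) fun a b h m => by
    have h1 := he a b h ((e a).symm m)
    rw [LinearEquiv.apply_symm_apply] at h1
    refine congrArg Subtype.val (a₂ := ⟨mono K (expo (q a) (q b)) • ((e a).symm m).1,
      X.mono_expo_smul_mem (q.monotone h) ((e a).symm m).2⟩) ?_
    rw [LinearEquiv.coe_coe, LinearEquiv.symm_apply_eq]
    exact Subtype.ext h1.symm
  hom_inv_id := pull_hom_ext fun a m => by
    rw [GrMod.comp_apply, pullHom_pullIncl, pullHom_pullIncl, LinearEquiv.coe_coe,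
      LinearEquiv.coe_coe, LinearEquiv.symm_apply_apply]
    rfl
  inv_hom_id := pull_hom_ext fun a m => by
    rw [GrMod.comp_apply, pullHom_pullIncl, pullHom_pullIncl, LinearEquiv.coe_coe,
      LinearEquiv.coe_coe, LinearEquiv.apply_symm_apply]
    rfl

theorem pullIso_hom_pullIncl (e : ∀ a, X.grading (q a) ≃ₗ[K] Y.grading (q' a)) (he)
    (a : Fin n → ℕ) (m : X.grading (q a)) :
    (pullIso e he).hom.1 (pullIncl q X a m) = pullIncl q' Y a (e a m) :=
  pullHom_pullIncl (fun a => (e a).toLinearMap) he a m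

/-- The component of degree `d = a` of `q^*X` as a component of `X`. -/
def pullGradingEquiv (q : (Fin n → ℕ) →o (Fin n → ℤ)) (X : GrMod K n) {a : Fin n → ℕ}
    {d b : Fin n → ℤ} (hd : natDeg a = d) (hb : q a = b) :
    ((pull q).obj X).grading d ≃ₗ[K] X.grading b :=
  LinearEquiv.ofEq _ _ (by rw [hd]) ≪≫ₗ (pullEquiv q X a).symm ≪≫ₗ
    LinearEquiv.ofEq _ _ (by rw [hb])

theorem pullGradingEquiv_eq_iff {a : Fin n → ℕ} {d b : Fin n → ℤ} (hd : natDeg a = d)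
    (hb : q a = b) (y : ((pull q).obj X).grading d) {m : X.carrier} (hm : m ∈ X.grading (q a)) :
    (pullGradingEquiv q X hd hb y : X.carrier) = m ↔ y.1 = pullIncl q X a ⟨m, hm⟩ := by
  subst hd hb
  change ((pullEquiv q X a).symm y : X.carrier) = m ↔ _
  rw [← coe_pullEquiv, ← Subtype.ext_iff, ← LinearEquiv.symm_apply_eq, Subtype.ext_iff]

theorem pullIncl_pullGradingEquiv {a : Fin n → ℕ} {d b : Fin n → ℤ} (hd : natDeg a = d)
    (hb : q a = b) (y : ((pull q).obj X).grading d)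
    (hm : (pullGradingEquiv q X hd hb y : X.carrier) ∈ X.grading (q a)) :
    pullIncl q X a ⟨pullGradingEquiv q X hd hb y, hm⟩ = y.1 :=
  ((pullGradingEquiv_eq_iff hd hb y hm).1 rfl).symm

end Pull

/-- If `p` takes values in `ℕⁿ`, then `p^* ∘ q^* ≅ (q ∘ p)^*`. -/
def pullCompIso (q p q' : (Fin n → ℕ) →o (Fin n → ℤ)) (hp : ∀ a, 0 ≤ p a)
    (hq : ∀ a, q (toNatVec (p a)) = q' a) :
    pull (K := K) q ⋙ pull p ≅ pull q' :=
  NatIso.ofComponents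
    (fun X => pullIso (q := p) (q' := q') (X := (pull q).obj X) (Y := X)
      (fun a => pullGradingEquiv q X (natDeg_toNatVec (hp a)) (hq a))
      (fun a b h m => by
        have hm : (pullGradingEquiv q X (natDeg_toNatVec (hp a)) (hq a) m : X.carrier) ∈
            X.grading (q (toNatVec (p a))) := by
          rw [hq]
          exact Subtype.property _
        have hk : toNatVec (p a) ≤ toNatVec (p b) := toNatVec_mono (p.monotone h)
        have h1 := mono_smul_pullIncl q X hk ⟨_, hm⟩
        rw [pullIncl_pullGradingEquiv, natDeg_toNatVec (hp a), natDeg_toNatVec (hp b)] at h1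
        have h2 : expo (q' a) (q' b) = expo (q (toNatVec (p a))) (q (toNatVec (p b))) := by
          rw [hq, hq]
        rw [h2]
        exact (pullGradingEquiv_eq_iff _ _ _ _).2 h1))
    (fun {X Y} f => pull_hom_ext fun a m => by
      have hm : (pullGradingEquiv q X (natDeg_toNatVec (hp a)) (hq a) m : X.carrier) ∈
          X.grading (q (toNatVec (p a))) := by
        rw [hq]
        exact Subtype.property _
      rw [GrMod.comp_apply, GrMod.comp_apply, pullIso_hom_pullIncl, pull_map_pullIncl]
      change (pullIso _ _).hom.1 (((pull p).map ((pull q).map f)).1 _) = _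
      rw [pull_map_pullIncl, pullIso_hom_pullIncl]
      refine congrArg (pullIncl q' Y a) (Subtype.ext ?_)
      refine (pullGradingEquiv_eq_iff _ _ _ (f.2 _ _ hm)).2 ?_
      rw [← pull_map_pullIncl q f _ ⟨_, hm⟩, pullIncl_pullGradingEquiv])

/-- Opposite shifts cancel. -/
def shiftCancelIso (a : Fin n → ℤ) : shift (K := K) a ⋙ shift (-a) ≅ 𝟭 _ :=
  NatIso.ofComponents
    (fun M =>
      { hom := ⟨LinearMap.id, fun b m hm => by
          change m ∈ M.grading (-a + (- -a + b)) at hm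
          rwa [neg_neg, neg_add_cancel_left] at hm⟩
        inv := ⟨LinearMap.id, fun b m hm => by
          change m ∈ M.grading (-a + (- -a + b))
          rwa [neg_neg, neg_add_cancel_left]⟩
        hom_inv_id := rfl
        inv_hom_id := rfl })
    (fun _ => rfl)

/-- `A_u ∘ D_u` is the graded bidual followed by `p_u^*`, because the two shifts cancel. -/
def dualADIso (K : Type u) [Field K] (u : Fin n → ℕ) :
    dualAD K u ≅ bidual K n ⋙ pull (pMap u) :=
  NatIso.ofComponents
    (fun M => (pull (pMap u)).mapIso ((grHom (injHull K n)).mapIso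
      ((shiftCancelIso (natDeg u)).app (polyDual M)).symm.op))
    (fun {M N} f => by
      have h := (shiftCancelIso (K := K) (natDeg u)).inv.naturality
        ((grHom (polyModule K n)).map f.op)
      have h' := congrArg (fun g => (pull (pMap u)).map ((grHom (injHull K n)).map g.op)) h
      simp only [op_comp, Functor.map_comp] at h'
      exact h'.symm)

/-! ### Functionals on positively determined modules -/

/-- On a positively `t`-determined module, multiplication by `x^e` is bijective in degree `a` if
`t_i ≤ a_i` for all `i` that occur in `e`. -/
theorem PosDet.bijOn_mono {t : Fin n → ℕ} {M : GrMod K n} (hM : PosDet K t M) (e : Fin n →₀ ℕ) :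
    ∀ a : Fin n → ℤ, (∀ i, e i ≠ 0 → (t i : ℤ) ≤ a i) →
      Set.BijOn (fun m : M.carrier => mono K e • m) (M.grading a) (M.grading (a + toDeg e)) := by
  induction e using Finsupp.induction_linear with
  | zero =>
    intro a _
    have h1 : toDeg (0 : Fin n →₀ ℕ) = 0 := by funext i; simp [toDeg]
    have h2 : (fun m : M.carrier => mono K (0 : Fin n →₀ ℕ) • m) = id := by
      funext m
      exact one_smul _ m
    rw [h1, h2, add_zero]
    exact Set.bijOn_id _
  | add e f he hf =>
    intro a h
    have h1 : (fun m : M.carrier => mono K (e + f) • m) =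
        (fun m => mono K e • m) ∘ fun m => mono K f • m := by
      funext m
      simp [mono, smul_smul, MvPolynomial.monomial_mul]
    have h2 : a + toDeg (e + f) = a + toDeg f + toDeg e := by
      funext i; simp [toDeg]; ring
    rw [h1, h2]
    refine (he _ fun i hi => ?_).comp (hf a fun i hi => ?_)
    · refine (h i (by simp [hi])).trans ?_
      simp [toDeg]
    · exact h i (by simp [hi])
  | single i k =>
    induction k with
    | zero =>
      intro a _
      have h1 : toDeg (Finsupp.single i 0 : Fin n →₀ ℕ) = 0 := by funext i; simp [toDeg]
      have h2 : (fun m : M.carrier => mono K (Finsupp.single i 0 : Fin n →₀ ℕ) • m) = id := by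
        funext m
        rw [Finsupp.single_zero]
        exact one_smul _ m
      rw [h1, h2, add_zero]
      exact Set.bijOn_id _
    | succ k ih =>
      intro a h
      have hi : (t i : ℤ) ≤ a i := h i (by simp)
      have h1 : (fun m : M.carrier => mono K (Finsupp.single i (k + 1)) • m) =
          (fun m => (MvPolynomial.X i : MvPolynomial (Fin n) K) • m) ∘
            fun m => mono K (Finsupp.single i k) • m := by
        funext m
        change _ = (MvPolynomial.X i : MvPolynomial (Fin n) K) • mono K (Finsupp.single i k) • m
        rw [smul_smul, MvPolynomial.X, MvPolynomial.monomial_mul, ← Finsupp.single_add,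
          add_comm 1 k, one_mul]
      have h2 : a + toDeg (Finsupp.single i (k + 1)) =
          a + toDeg (Finsupp.single i k) + Pi.single i 1 := by
        funext j
        by_cases hj : j = i
        · subst hj; simp [toDeg]; ring
        · simp [toDeg, hj]
      rw [h1, h2]
      refine (hM.2.2 i _ ?_).comp (ih a fun j hj => ?_)
      · simp [toDeg]; omega
      · obtain rfl : i = j := by
          by_contra hne
          exact hj (Finsupp.single_eq_of_ne (Ne.symm hne))
        exact hi

theorem PosDet.bijOn_expo {t : Fin n → ℕ} {M : GrMod K n} (hM : PosDet K t M) {a b : Fin n → ℤ}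
    (h : a ≤ b) (ht : ∀ i, a i = b i ∨ (t i : ℤ) ≤ a i) :
    Set.BijOn (fun m : M.carrier => mono K (expo a b) • m) (M.grading a) (M.grading b) := by
  have h1 := hM.bijOn_mono (expo a b) a fun i hi => (ht i).resolve_left fun h0 => hi (by
    simp [expo, h0])
  rwa [toDeg_expo h, add_sub_cancel] at h1

/-- Multiplication by `x^{b-a}` from `M_a` to `M_b`. -/
def GrMod.monoMap (M : GrMod K n) {a b : Fin n → ℤ} (h : a ≤ b) :
    M.grading a →ₗ[K] M.grading b where
  toFun m := ⟨mono K (expo a b) • m.1, M.mono_expo_smul_mem h m.2⟩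
  map_add' _ _ := Subtype.ext (smul_add _ _ _)
  map_smul' _ _ := Subtype.ext (smul_comm _ _ _)

/-- A functional invariant under monomials is determined by its values in a degree
`T ≥ t`. -/
theorem PosDet.functional_ext {t : Fin n → ℕ} {M : GrMod K n} (hM : PosDet K t M)
    {T : Fin n → ℤ} (hT : natDeg t ≤ T) {l l' : Module.Dual K M.carrier}
    (hl : ∀ (d : Fin n →₀ ℕ) m, l (mono K d • m) = l m)
    (hl' : ∀ (d : Fin n →₀ ℕ) m, l' (mono K d • m) = l' m)
    (h : ∀ m ∈ M.grading T, l m = l' m) : l = l' := by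
  refine M.linearMap_ext fun a m hm => ?_
  obtain ⟨w, hw, hwm⟩ := (hM.bijOn_expo (b := a ⊔ T) le_sup_right fun i => Or.inr (hT i)).surjOn
    (M.mono_expo_smul_mem le_sup_left hm)
  dsimp only at hwm
  rw [← hl (expo a (a ⊔ T)), ← hl' (expo a (a ⊔ T)), ← hwm, hl, hl', h w hw]

section Extend

variable {t : Fin n → ℕ} {M : GrMod K n} (hM : PosDet K t M) {T : Fin n → ℤ}
  (hT : natDeg t ≤ T)

/-- Multiplication by a monomial is an isomorphism between components of degree at least `t`. -/
def PosDet.monoEquiv {b : Fin n → ℤ} (h : T ≤ b) : M.grading T ≃ₗ[K] M.grading b :=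
  LinearEquiv.ofBijective (M.monoMap h) (by
    have hb := hM.bijOn_expo h fun i => Or.inr (hT i)
    refine ⟨fun x y hxy => Subtype.ext (hb.injOn x.2 y.2 (congrArg Subtype.val hxy)), fun y => ?_⟩
    obtain ⟨x, hx, hxy⟩ := hb.surjOn y.2
    exact ⟨⟨x, hx⟩, Subtype.ext hxy⟩)

/-- The extension of a linear form on `M_T`, `T ≥ t`, to a functional on `M` that is invariant under
multiplication by monomials: for `m ∈ M_a` there is a unique `w ∈ M_T` such that `m` and `w` have
the same multiple in degree `max(a, T)`, and `m` has the value of `w`. -/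
def PosDet.extend (ν : Module.Dual K (M.grading T)) : Module.Dual K M.carrier :=
  M.glue fun a => ν ∘ₗ (hM.monoEquiv hT (le_sup_right : T ≤ a ⊔ T)).symm.toLinearMap ∘ₗ
    M.monoMap le_sup_left

theorem PosDet.extend_eq (ν : Module.Dual K (M.grading T)) {a b : Fin n → ℤ} (ha : a ≤ b)
    (hb : T ≤ b) {m : M.carrier} (hm : m ∈ M.grading a) (w : M.grading T)
    (h : mono K (expo T b) • w.1 = mono K (expo a b) • m) : hM.extend hT ν m = ν w := by
  rw [extend, GrMod.glue_of_mem _ _ hm]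
  change ν ((hM.monoEquiv hT (le_sup_right : T ≤ a ⊔ T)).symm (M.monoMap le_sup_left ⟨m, hm⟩)) = _
  congr 1
  rw [LinearEquiv.symm_apply_eq]
  refine Subtype.ext ?_
  change mono K (expo a (a ⊔ T)) • m = mono K (expo T (a ⊔ T)) • w.1
  refine (hM.bijOn_expo (sup_le ha hb) fun i => Or.inr ((hT i).trans le_sup_right)).injOn
    (M.mono_expo_smul_mem le_sup_left hm) (M.mono_expo_smul_mem le_sup_right w.2) ?_
  change mono K (expo (a ⊔ T) b) • mono K (expo a (a ⊔ T)) • m =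
    mono K (expo (a ⊔ T) b) • mono K (expo T (a ⊔ T)) • w.1
  rw [smul_smul, smul_smul, mono_expo_mul K le_sup_left (sup_le ha hb),
    mono_expo_mul K le_sup_right (sup_le ha hb), h]

theorem PosDet.extend_mono_smul (ν : Module.Dual K (M.grading T)) (d : Fin n →₀ ℕ)
    (m : M.carrier) : hM.extend hT ν (mono K d • m) = hM.extend hT ν m := by
  refine M.homogeneous_induction
    (P := fun m => hM.extend hT ν (mono K d • m) = hM.extend hT ν m) m
    (fun a m hm => ?_) fun x y hx hy => by rw [smul_add, map_add, map_add, hx, hy]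
  have ha := le_add_toDeg a d
  have hd := M.mono_smul_mem d hm
  obtain ⟨w, hw, hwm⟩ := (hM.bijOn_expo (b := (a + toDeg d) ⊔ T) le_sup_right
    fun i => Or.inr (hT i)).surjOn (M.mono_expo_smul_mem le_sup_left hd)
  dsimp only at hwm
  rw [hM.extend_eq hT ν le_sup_left le_sup_right hd ⟨w, hw⟩ hwm,
    hM.extend_eq hT ν (ha.trans le_sup_left) le_sup_right hm ⟨w, hw⟩]
  rw [hwm, ← mono_expo_mul K ha le_sup_left, mul_smul, GrMod.expo_add_toDeg]

theorem PosDet.extend_of_mem (ν : Module.Dual K (M.grading T)) (m : M.grading T) :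
    hM.extend hT ν m.1 = ν m :=
  hM.extend_eq hT ν le_rfl le_rfl m.2 m rfl

end Extend

/-! ### Comparison of functionals on `M` and on `q^*M` -/

/-- The `K`-linear map `q^*M → M` that is the inclusion on each component
`(q^*M)_a = M_{q(a)}`. -/
def collapse (q : (Fin n → ℕ) →o (Fin n → ℤ)) (M : GrMod K n) :
    ((pull q).obj M).carrier →ₗ[K] M.carrier :=
  DirectSum.toModule K (Fin n → ℤ) M.carrier fun d => (pullComp q M d).subtype

theorem collapse_pullIncl (q : (Fin n → ℕ) →o (Fin n → ℤ)) (M : GrMod K n) (a : Fin n → ℕ)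
    (m : M.grading (q a)) : collapse q M (pullIncl q M a m) = m.1 :=
  DirectSum.toModule_lof (M := (pullData q M).space) K (natDeg a) _

theorem collapse_map (q : (Fin n → ℕ) →o (Fin n → ℤ)) {M N : GrMod K n} (f : M ⟶ N)
    (y : ((pull q).obj M).carrier) :
    collapse q N (((pull q).map f).1 y) = f.1 (collapse q M y) := by
  refine pull_induction
    (P := fun y => collapse q N (((pull q).map f).1 y) = f.1 (collapse q M y)) y
    (fun a m => ?_) fun x y hx hy => by
      rw [map_add, map_add, map_add, map_add, hx, hy]
  rw [pull_map_pullIncl, collapse_pullIncl, collapse_pullIncl]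

/-- The pullback of functionals along `collapse`. -/
def functionalsPull {q : (Fin n → ℕ) →o (Fin n → ℤ)} {c ε : Fin n → ℤ}
    (h : ∀ b, ¬ ε ≤ natDeg b → ¬ c ≤ q b) (M : GrMod K n) :
    functionals M c →ₗ[K] functionals ((pull q).obj M) ε where
  toFun l := ⟨l.1.comp (collapse q M), by
    have hl := mem_functionals.1 l.2
    refine mem_functionals.2 ⟨fun d y => ?_, fun a ha y hy => ?_⟩
    · refine pull_induction
        (P := fun y => l.1 (collapse q M (mono K d • y)) = l.1 (collapse q M y)) y
        (fun a m => ?_) fun x y hx hy => by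
          rw [smul_add, map_add, map_add, map_add, map_add, hx, hy]
      have hd : expo (natDeg a) (natDeg (a + ⇑d)) = d := by
        ext i
        simp [expo, natDeg]
      have h1 := mono_smul_pullIncl q M (le_self_add : a ≤ a + ⇑d) m
      rw [hd] at h1
      rw [h1, collapse_pullIncl, collapse_pullIncl, hl.1]
    · by_cases h0 : 0 ≤ a
      · obtain ⟨b, rfl⟩ : ∃ b, natDeg b = a := ⟨_, natDeg_toNatVec h0⟩
        obtain ⟨m, rfl⟩ := exists_pullIncl q M hy
        change l.1 (collapse q M _) = 0
        rw [collapse_pullIncl]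
        exact hl.2 _ (h b ha) _ m.2
      · rw [pull_grading_eq_bot q M h0, Submodule.mem_bot] at hy
        rw [hy, map_zero]⟩
  map_add' _ _ := rfl
  map_smul' _ _ := rfl

/-- The situation common to both isomorphisms: for some `0 ≤ l < t`, `q(a)_i` is `t_i` or `l_i`, and
`c(a)_i` is `l_i + 1` or `0`, according to whether `a_i ≥ 1` or `a_i = 0`. -/
structure IsStepPair (t : Fin n → ℕ) (l : Fin n → ℤ) (q c : (Fin n → ℕ) →o (Fin n → ℤ)) :
    Prop where
  nonneg : ∀ i, 0 ≤ l i
  lt : ∀ i, l i < t i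
  q_of_pos : ∀ a i, 1 ≤ a i → q a i = t i
  q_of_zero : ∀ a i, a i = 0 → q a i = l i
  c_of_pos : ∀ a i, 1 ≤ a i → c a i = l i + 1
  c_of_zero : ∀ a i, a i = 0 → c a i = 0

namespace IsStepPair

variable {t : Fin n → ℕ} {l : Fin n → ℤ} {q c : (Fin n → ℕ) →o (Fin n → ℤ)}

theorem exists_of_not_le {a : Fin n → ℕ} {d : Fin n → ℤ} (h0 : 0 ≤ d) (h : ¬ pMap 1 a ≤ d) :
    ∃ i, 1 ≤ a i ∧ d i < 1 := by
  obtain ⟨i, hi⟩ := not_forall.1 (Pi.le_def.not.1 h)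
  have h1 : 0 ≤ d i := h0 i
  refine ⟨i, ?_⟩
  simp only [pMap, OrderHom.coe_mk, Pi.one_apply, Nat.cast_one, not_le] at hi
  split_ifs at hi <;> omega

theorem not_le (hs : IsStepPair t l q c) (a b : Fin n → ℕ) (h : ¬ pMap 1 a ≤ natDeg b) :
    ¬ c a ≤ q b := by
  obtain ⟨i, hi, hb⟩ := exists_of_not_le (natDeg_nonneg b) h
  intro hle
  have h1 : c a i ≤ q b i := hle i
  have hb0 : b i = 0 := by simp only [natDeg] at hb; omega
  rw [hs.c_of_pos a i hi, hs.q_of_zero b i hb0] at h1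
  omega

theorem q_eq (hs : IsStepPair t l q c) {b : Fin n → ℕ} (hb : 1 ≤ b) : q b = natDeg t :=
  funext fun i => hs.q_of_pos b i (hb i)

theorem q_le (hs : IsStepPair t l q c) (b : Fin n → ℕ) : q b ≤ natDeg t := by
  rw [← hs.q_eq (b := b ⊔ 1) le_sup_right]
  exact q.monotone le_sup_left

variable {M : GrMod K n}

theorem functionalsPull_injective (hs : IsStepPair t l q c) (hM : PosDet K t M)
    (a : Fin n → ℕ) : Function.Injective (functionalsPull (hs.not_le a) M) := by
  intro f g hfg
  refine Subtype.ext (hM.functional_ext (T := q 1) (hs.q_eq le_rfl).ge f.2.1 g.2.1 fun m hm => ?_)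
  have h := LinearMap.congr_fun (congrArg Subtype.val hfg) (pullIncl q M 1 ⟨m, hm⟩)
  change f.1 (collapse q M _) = g.1 (collapse q M _) at h
  rwa [collapse_pullIncl] at h

/-- A functional `μ` on `q^*M` comes from the functional on `M` that extends the restriction of `μ`
to `(q^*M)_1 = M_t`. -/
theorem functionalsPull_surjective (hs : IsStepPair t l q c) (hM : PosDet K t M)
    (a : Fin n → ℕ) : Function.Surjective (functionalsPull (hs.not_le a) M) := by
  intro μ
  have hT : natDeg t ≤ q 1 := (hs.q_eq le_rfl).ge
  set L := hM.extend hT (μ.1 ∘ₗ pullIncl q M 1) with hL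
  have inv : ∀ (d : Fin n →₀ ℕ) m, L (mono K d • m) = L m := hM.extend_mono_smul hT _
  have key : ∀ y, L (collapse q M y) = μ.1 y := by
    intro y
    refine pull_induction (P := fun y => L (collapse q M y) = μ.1 y) y (fun b m => ?_)
      fun x y hx hy => by rw [map_add, map_add, map_add, hx, hy]
    have hq1 : q (b ⊔ 1) = q 1 := (hs.q_eq le_sup_right).trans (hs.q_eq le_rfl).symm
    have hqb : q b ≤ q 1 := (hs.q_le b).trans hT
    have hz := M.mono_expo_smul_mem hqb m.2
    rw [collapse_pullIncl, ← inv (expo (q b) (q 1)),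
      hM.extend_of_mem hT _ ⟨mono K (expo (q b) (q 1)) • m.1, hz⟩,
      ← μ.2.1 (expo (natDeg b) (natDeg (b ⊔ 1))), mono_smul_pullIncl q M le_sup_left]
    change μ.1 (pullIncl q M 1 _) = _
    rw [← μ.2.1 (expo (natDeg 1) (natDeg (b ⊔ 1))), mono_smul_pullIncl q M le_sup_right]
    congr 2
    refine Subtype.ext ?_
    change mono K (expo (q 1) (q (b ⊔ 1))) • mono K (expo (q b) (q 1)) • m.1 =
      mono K (expo (q b) (q (b ⊔ 1))) • m.1
    rw [hq1, mono_expo_self, one_smul]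
  refine ⟨⟨L, mem_functionals.2 ⟨inv, fun d hd m hm => ?_⟩⟩, Subtype.ext (LinearMap.ext key)⟩
  by_cases h0 : 0 ≤ d
  · obtain ⟨i, hi⟩ := not_forall.1 (Pi.le_def.not.1 hd)
    have hd0 : 0 ≤ d i := h0 i
    have hai : 1 ≤ a i := by
      by_contra hai
      rw [hs.c_of_zero a i (by omega)] at hi
      exact hi hd0
    rw [hs.c_of_pos a i hai] at hi
    -- With `j` vanishing only at `i`, some monomial multiple of `m` is also a multiple of some
    -- `z ∈ M_{q(j)}`, so `L m = L z`, and `μ` vanishes in degree `j` because `a_i ≥ 1`.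
    let j : Fin n → ℕ := Function.update 1 i 0
    have hj : q j i = l i := hs.q_of_zero j i (by simp [j])
    have hj' : ∀ k, k ≠ i → q j k = t k := fun k hk => hs.q_of_pos j k (by simp [j, hk])
    obtain ⟨z, hz, hzm⟩ := (hM.bijOn_expo (a := q j) (b := d ⊔ q j) le_sup_right fun k => by
      by_cases hk : k = i
      · subst hk
        left
        rw [Pi.sup_apply, hj, max_eq_right (by omega)]
      · exact Or.inr (hj' k hk).ge).surjOn (M.mono_expo_smul_mem le_sup_left hm)
    dsimp only at hzm
    rw [← inv (expo d (d ⊔ q j)), ← hzm, inv]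
    have h1 := key (pullIncl q M j ⟨z, hz⟩)
    rw [collapse_pullIncl] at h1
    rw [h1]
    refine μ.2.2 (natDeg j) (fun hle => ?_) _ (pullIncl_mem q M j _)
    have h2 := hle i
    simp [pMap, natDeg, j] at h2
    omega
  · have hm0 : m = 0 := by
      rwa [hM.2.1 d h0, Submodule.mem_bot] at hm
    rw [hm0, map_zero]

/-- For a positively `t`-determined module `M`, functionals on `M` and on `q^*M` correspond. -/
def functionalsEquiv (hs : IsStepPair t l q c) (hM : PosDet K t M) (a : Fin n → ℕ) :
    functionals M (c a) ≃ₗ[K] functionals ((pull q).obj M) (pMap 1 a) :=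
  LinearEquiv.ofBijective (functionalsPull (hs.not_le a) M)
    ⟨hs.functionalsPull_injective hM a, hs.functionalsPull_surjective hM a⟩

/-- The isomorphism `B(q^*M)_{p_1(a)} ≃ B(M)_{c(a)}` dual to `functionalsEquiv`. -/
def componentEquiv (hs : IsStepPair t l q c) (hM : PosDet K t M) (a : Fin n → ℕ) :
    ((bidual K n).obj ((pull q).obj M)).grading (pMap 1 a) ≃ₗ[K]
      ((bidual K n).obj M).grading (c a) :=
  bidualEquiv ((pull q).obj M) (pMap 1 a) ≪≫ₗ (hs.functionalsEquiv hM a).dualMap ≪≫ₗ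
    (bidualEquiv M (c a)).symm

theorem bidualEquiv_componentEquiv (hs : IsStepPair t l q c) (hM : PosDet K t M)
    (a : Fin n → ℕ) (y : ((bidual K n).obj ((pull q).obj M)).grading (pMap 1 a))
    (f : functionals M (c a)) :
    bidualEquiv M (c a) (hs.componentEquiv hM a y) f =
      bidualEquiv ((pull q).obj M) (pMap 1 a) y (hs.functionalsEquiv hM a f) := by
  simp [componentEquiv]

/-- The isomorphism `p_1^*(B(q^*M)) ≅ c^*(B(M))` for a positively `t`-determined module `M`. -/
def objIso (hs : IsStepPair t l q c) (hM : PosDet K t M) :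
    (pull (pMap 1)).obj ((bidual K n).obj ((pull q).obj M)) ≅
      (pull c).obj ((bidual K n).obj M) :=
  pullIso (hs.componentEquiv hM) fun a b h y => by
    refine congrArg Subtype.val (a₂ := ⟨mono K (expo (c a) (c b)) •
      (hs.componentEquiv hM a y).1, GrMod.mono_expo_smul_mem _ (c.monotone h)
        (hs.componentEquiv hM a y).2⟩) ?_
    refine (bidualEquiv M (c b)).injective (LinearMap.ext fun f => ?_)
    rw [bidualEquiv_componentEquiv, bidualEquiv_mono_smul _ ((pMap 1).monotone h),
      bidualEquiv_mono_smul _ (c.monotone h), bidualEquiv_componentEquiv]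
    rfl

theorem objIso_naturality (hs : IsStepPair t l q c) {M N : GrMod K n} (hM : PosDet K t M)
    (hN : PosDet K t N) (f : M ⟶ N) :
    (pull (pMap 1)).map ((bidual K n).map ((pull q).map f)) ≫ (hs.objIso hN).hom =
      (hs.objIso hM).hom ≫ (pull c).map ((bidual K n).map f) :=
  pull_hom_ext fun a y => by
    rw [GrMod.comp_apply, GrMod.comp_apply, objIso, objIso, pull_map_pullIncl,
      pullIso_hom_pullIncl, pullIso_hom_pullIncl, pull_map_pullIncl]
    refine congrArg _ ((bidualEquiv N (c a)).injective (LinearMap.ext fun g => ?_))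
    rw [bidualEquiv_componentEquiv, bidualEquiv_map, bidualEquiv_map, bidualEquiv_componentEquiv]
    refine congrArg _ (Subtype.ext (LinearMap.ext fun z => ?_))
    exact congrArg g.1 (collapse_map q f z)

/-- The isomorphism `p_1^* ∘ B ∘ q^* ≅ c^* ∘ B` of functors on `Mod_t`, where `B` is the graded
bidual. -/
def stepIso (hs : IsStepPair t l q c) :
    (PosDet K t).ι ⋙ pull q ⋙ bidual K n ⋙ pull (pMap 1) ≅
      (PosDet K t).ι ⋙ bidual K n ⋙ pull c :=
  NatIso.ofComponents (fun M => hs.objIso M.property)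
    fun {M N} f => hs.objIso_naturality M.property N.property f.hom

end IsStepPair

/-! ### Finiteness and positively `1`-determined values -/

/-- The homogeneous components of a finitely generated graded module are finite-dimensional. -/
theorem GrMod.finite_grading (M : GrMod K n) [hM : Module.Finite (MvPolynomial (Fin n) K) M.carrier]
    (d : Fin n → ℤ) : Module.Finite K (M.grading d) := by
  let f : M.carrier → MvPolynomial (Fin n) K →ₗ[K] M.grading d := fun g =>
    M.proj d ∘ₗ (LinearMap.toSpanSingleton (MvPolynomial (Fin n) K) M.carrier g).restrictScalars K
  have hf : ∀ g p, f g p = M.proj d (p • g) := fun _ _ => rfl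
  have fin : ∀ g, (LinearMap.range (f g)).FG := by
    intro g
    refine M.homogeneous_induction (P := fun g => (LinearMap.range (f g)).FG) g
      (fun b g hg => ?_) fun x y hx hy => ?_
    · -- The only monomial multiple of `g` of degree `d` is `x^{d-b} g`.
      refine (Submodule.fg_span_singleton (M.proj d (mono K (expo b d) • g))).of_le ?_
      rintro _ ⟨p, rfl⟩
      rw [p.as_sum, map_sum]
      refine Submodule.sum_mem _ fun c _ => ?_
      rw [hf, M.monomial_smul c (p.coeff c), map_smul (M.proj d) (p.coeff c)]
      refine Submodule.smul_mem _ _ ?_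
      by_cases hc : b + toDeg c = d
      · rw [← hc, expo_add_toDeg]
        exact Submodule.mem_span_singleton_self _
      · rw [M.proj_of_mem_ne (M.mono_smul_mem c hg) hc]
        exact Submodule.zero_mem _
    · refine (hx.sup hy).of_le ?_
      rintro _ ⟨p, rfl⟩
      rw [hf, smul_add, map_add]
      exact Submodule.add_mem_sup ⟨p, rfl⟩ ⟨p, rfl⟩
  obtain ⟨G, hG⟩ := hM.fg_top
  have top : (⊤ : Submodule K (M.grading d)) = ⨆ g ∈ G, LinearMap.range (f g) := by
    rw [eq_comm, eq_top_iff]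
    rintro ⟨m, hm⟩ _
    have h : ∀ (m : M.carrier) (p : MvPolynomial (Fin n) K),
        M.proj d (p • m) ∈ ⨆ g ∈ G, LinearMap.range (f g) := by
      intro m
      have hm : m ∈ Submodule.span (MvPolynomial (Fin n) K) (G : Set M.carrier) := by
        rw [hG]; trivial
      induction hm using Submodule.span_induction with
      | mem x hx =>
        exact fun p => Submodule.mem_iSup_of_mem x (Submodule.mem_iSup_of_mem hx ⟨p, rfl⟩)
      | zero => intro p; rw [smul_zero, map_zero]; exact Submodule.zero_mem _
      | add x y _ _ hx hy =>
        intro p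
        rw [smul_add, map_add]
        exact Submodule.add_mem _ (hx p) (hy p)
      | smul r x _ hx => intro p; rw [smul_smul]; exact hx _
    rw [← M.proj_of_mem hm, ← one_smul (MvPolynomial (Fin n) K) m]
    exact h m 1
  exact ⟨top ▸ Submodule.fg_biSup G _ fun g _ => fin g⟩

theorem PosDet.finite_functionals {t : Fin n → ℕ} {M : GrMod K n} (hM : PosDet K t M)
    (c : Fin n → ℤ) : Module.Finite K (functionals M c) := by
  have := hM.1
  have := M.finite_grading (natDeg t)
  let f : functionals M c →ₗ[K] Module.Dual K (M.grading (natDeg t)) :=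
    (M.grading (natDeg t)).subtype.dualMap ∘ₗ (functionals M c).subtype
  refine Module.Finite.of_injective f fun l l' h => Subtype.ext ?_
  exact hM.functional_ext le_rfl l.2.1 l'.2.1 fun m hm => LinearMap.congr_fun h ⟨m, hm⟩

theorem PosDet.finite_bidual_grading {t : Fin n → ℕ} {M : GrMod K n} (hM : PosDet K t M)
    (c : Fin n → ℤ) : Module.Finite K (((bidual K n).obj M).grading c) := by
  have := hM.finite_functionals c
  obtain ⟨k, f, hf⟩ := Module.Finite.exists_fin' K (functionals M c)
  have : Module.Finite K (Module.Dual K (functionals M c)) :=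
    Module.Finite.of_injective f.dualMap (LinearMap.dualMap_injective_of_surjective hf)
  exact Module.Finite.equiv (bidualEquiv M c).symm

theorem iso_hom_bijOn {M N : GrMod K n} (e : M ≅ N) (a : Fin n → ℤ) :
    Set.BijOn e.hom.1 (M.grading a) (N.grading a) := by
  have h1 : ∀ m, e.inv.1 (e.hom.1 m) = m := fun m =>
    LinearMap.congr_fun (congrArg Subtype.val e.hom_inv_id) m
  have h2 : ∀ m, e.hom.1 (e.inv.1 m) = m := fun m =>
    LinearMap.congr_fun (congrArg Subtype.val e.inv_hom_id) m
  exact Set.InvOn.bijOn ⟨fun m _ => h1 m, fun m _ => h2 m⟩ (fun m hm => e.hom.2 a m hm)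
    fun m hm => e.inv.2 a m hm

/-- Being positively `t`-determined is invariant under isomorphism. -/
theorem PosDet.of_iso {t : Fin n → ℕ} {M N : GrMod K n} (hM : PosDet K t M) (e : M ≅ N) :
    PosDet K t N := by
  have h2 : ∀ m, e.hom.1 (e.inv.1 m) = m := fun m =>
    LinearMap.congr_fun (congrArg Subtype.val e.inv_hom_id) m
  refine ⟨?_, fun a ha => ?_, fun i a hi => ?_⟩
  · have := hM.1
    exact Module.Finite.of_surjective e.hom.1 fun m => ⟨_, h2 m⟩
  · rw [eq_bot_iff]
    intro m hm
    have h := e.inv.2 a m hm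
    rw [hM.2.1 a ha, Submodule.mem_bot] at h
    rw [Submodule.mem_bot, ← h2 m, h, map_zero]
  · have h := ((iso_hom_bijOn e _).comp (hM.2.2 i a hi)).comp
      (iso_hom_bijOn e.symm a)
    refine h.congr fun m _ => ?_
    change e.hom.1 ((MvPolynomial.X i : MvPolynomial (Fin n) K) • e.inv.1 m) =
      (MvPolynomial.X i : MvPolynomial (Fin n) K) • m
    rw [map_smul, h2]

/-- `c^*X` is generated by its components in degrees `a ∈ {0,1}ⁿ`. -/
theorem finite_pull {c : (Fin n → ℕ) →o (Fin n → ℤ)}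
    (hc : ∀ a, c (a ⊓ 1) = c a) (X : GrMod K n) (hX : ∀ a, Module.Finite K (X.grading (c a))) :
    Module.Finite (MvPolynomial (Fin n) K) ((pull c).obj X).carrier := by
  let ind : (Fin n → Fin 2) → Fin n → ℕ := fun s i => s i
  let N : Submodule (MvPolynomial (Fin n) K) ((pull c).obj X).carrier :=
    ⨆ s : Fin n → Fin 2, Submodule.span (MvPolynomial (Fin n) K)
      (LinearMap.range (pullIncl c X (ind s)) : Set ((pull c).obj X).carrier)
  have hN : N.FG := by
    refine Submodule.fg_iSup _ fun s => ?_
    obtain ⟨T, hT⟩ := (hX (ind s)).fg_top.map (pullIncl c X (ind s))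
    rw [Submodule.map_top] at hT
    rw [← hT, Submodule.span_span_of_tower]
    exact ⟨T, rfl⟩
  have hmem : ∀ y, y ∈ N := by
    intro y
    refine pull_induction (P := fun y => y ∈ N) y (fun a m => ?_) fun x y hx hy => N.add_mem hx hy
    have hs : ∃ s, ind s = a ⊓ 1 :=
      ⟨fun i => ⟨(a ⊓ 1) i, Nat.lt_succ_of_le inf_le_right⟩, rfl⟩
    obtain ⟨s, hs⟩ := hs
    have hm : m.1 ∈ X.grading (c (a ⊓ 1)) := by rw [hc]; exact m.2
    have h := mono_smul_pullIncl c X (inf_le_left : a ⊓ 1 ≤ a) ⟨m.1, hm⟩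
    have h' : pullIncl c X a m =
        mono K (expo (natDeg (a ⊓ 1)) (natDeg a)) • pullIncl c X (a ⊓ 1) ⟨m.1, hm⟩ := by
      rw [h]
      refine congrArg _ (Subtype.ext ?_)
      change m.1 = mono K (expo (c (a ⊓ 1)) (c a)) • m.1
      rw [hc, mono_expo_self, one_smul]
    rw [h']
    refine N.smul_mem _ (Submodule.mem_iSup_of_mem s (Submodule.subset_span ?_))
    rw [hs]
    exact ⟨_, rfl⟩
  exact ⟨by rwa [(eq_top_iff.2 fun y _ => hmem y : N = ⊤)] at hN⟩

/-- If `c` only depends on which coordinates vanish, then `c^*X` is positively `1`-determined as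
soon as its components are finite-dimensional. -/
theorem posDet_one_pull {c : (Fin n → ℕ) →o (Fin n → ℤ)}
    (hc : ∀ a, c (a ⊓ 1) = c a) (X : GrMod K n) (hX : ∀ a, Module.Finite K (X.grading (c a))) :
    PosDet K 1 ((pull c).obj X) := by
  refine ⟨finite_pull hc X hX, fun a ha => pull_grading_eq_bot c X ha, fun i d hi => ?_⟩
  rw [Pi.one_apply, Nat.cast_one] at hi
  by_cases hd : 0 ≤ d
  · obtain ⟨a, rfl⟩ : ∃ a, natDeg a = d := ⟨_, natDeg_toNatVec hd⟩
    have hai : 1 ≤ a i := by simpa [natDeg] using hi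
    have hab : a ≤ a + Pi.single i 1 := le_self_add
    have hdeg : natDeg a + Pi.single i 1 = natDeg (a + Pi.single i 1) := by
      funext j
      by_cases hj : j = i
      · subst hj; simp [natDeg]
      · simp [natDeg, hj]
    have hcab : c (a + Pi.single i 1) = c a := by
      rw [← hc a, ← hc (a + Pi.single i 1)]
      congr 1
      funext j
      by_cases hj : j = i
      · subst hj; simp; omega
      · simp [hj]
    have hX' : (MvPolynomial.X i : MvPolynomial (Fin n) K) =
        mono K (expo (natDeg a) (natDeg (a + Pi.single i 1))) := by
      rw [MvPolynomial.X]
      congr 2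
      ext j
      by_cases hj : j = i
      · subst hj; simp [expo, natDeg]
      · simp [expo, natDeg, hj]
    have key : ∀ (m : X.carrier) (hm : m ∈ X.grading (c a))
        (hm' : m ∈ X.grading (c (a + Pi.single i 1))),
        (MvPolynomial.X i : MvPolynomial (Fin n) K) • pullIncl c X a ⟨m, hm⟩ =
          pullIncl c X (a + Pi.single i 1) ⟨m, hm'⟩ := by
      intro m hm hm'
      rw [hX', mono_smul_pullIncl c X hab]
      refine congrArg _ (Subtype.ext ?_)
      change mono K (expo (c a) (c (a + Pi.single i 1))) • m = m
      rw [hcab, mono_expo_self, one_smul]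
    rw [hdeg]
    refine ⟨fun y hy => ?_, fun y hy z hz h => ?_, fun y hy => ?_⟩
    · obtain ⟨⟨m, hm⟩, rfl⟩ := exists_pullIncl c X hy
      dsimp only
      rw [key m hm (by rwa [hcab])]
      exact pullIncl_mem c X _ _
    · obtain ⟨⟨m, hm⟩, rfl⟩ := exists_pullIncl c X hy
      obtain ⟨⟨m', hm'⟩, rfl⟩ := exists_pullIncl c X hz
      dsimp only at h
      rw [key m hm (by rwa [hcab]), key m' hm' (by rwa [hcab])] at h
      have := congrArg Subtype.val (pullIncl_injective c X _ h)
      dsimp only at this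
      subst this
      rfl
    · obtain ⟨⟨m, hm⟩, rfl⟩ := exists_pullIncl c X hy
      have hm' : m ∈ X.grading (c a) := by rwa [← hcab]
      exact ⟨pullIncl c X a ⟨m, hm'⟩, pullIncl_mem c X _ _, key m hm' hm⟩
  · have hd' : ¬ 0 ≤ d + Pi.single i 1 := by
      intro h
      refine hd fun j => ?_
      by_cases hj : j = i
      · subst hj
        exact le_trans zero_le_one hi
      · simpa [hj] using h j
    rw [pull_grading_eq_bot c X hd, pull_grading_eq_bot c X hd']
    simp [Set.bijOn_singleton]

theorem IsStepPair.c_inf_one {t : Fin n → ℕ} {l : Fin n → ℤ} {q c : (Fin n → ℕ) →o (Fin n → ℤ)}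
    (hs : IsStepPair t l q c) (a : Fin n → ℕ) : c (a ⊓ 1) = c a := by
  funext i
  by_cases h : 1 ≤ a i
  · rw [hs.c_of_pos a i h, hs.c_of_pos (a ⊓ 1) i (by simpa using h)]
  · rw [hs.c_of_zero a i (by omega), hs.c_of_zero (a ⊓ 1) i (by simp; omega)]

/-- The module `c^*B(M)` is positively `1`-determined. -/
theorem IsStepPair.posDet_one {t : Fin n → ℕ} {l : Fin n → ℤ}
    {q c : (Fin n → ℕ) →o (Fin n → ℤ)} (hs : IsStepPair t l q c) {M : GrMod K n}
    (hM : PosDet K t M) : PosDet K 1 ((pull c).obj ((bidual K n).obj M)) :=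
  posDet_one_pull hs.c_inf_one _ fun _ => hM.finite_bidual_grading _

/-! ### The two isomorphisms -/

theorem isStepPair_rMap {t : Fin n → ℕ} (ht : ∀ i, 1 ≤ t i) :
    IsStepPair t 0 (rMap t) (pMap 1) where
  nonneg _ := le_rfl
  lt i := Int.natCast_pos.2 (ht i)
  q_of_pos _ _ h := if_pos h
  q_of_zero _ _ h := if_neg (by omega)
  c_of_pos _ _ h := (if_neg (by simp; omega)).trans (by simp)
  c_of_zero a i h := (if_pos (by simp [h])).trans (by simp [h])

theorem isStepPair_sMap {t : Fin n → ℕ} (ht : ∀ i, 1 ≤ t i) :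
    IsStepPair t (fun i => t i - 1) (sMap t) (rMap t) where
  nonneg i := by have := ht i; omega
  lt i := by omega
  q_of_pos _ _ h := if_pos h
  q_of_zero _ _ h := if_neg (by omega)
  c_of_pos _ _ h := (if_pos h).trans (by omega)
  c_of_zero _ _ h := if_neg (by omega)

/-- `A_1 ∘ D_1 ∘ q^* ≅ c^* ∘ A_t ∘ D_t` on `Mod_t`, provided that `p_t ∘ c = c`. -/
def IsStepPair.dualIso {t : Fin n → ℕ} {l : Fin n → ℤ} {q c : (Fin n → ℕ) →o (Fin n → ℤ)}
    (hs : IsStepPair t l q c) (h0 : ∀ a, 0 ≤ c a) (hc : ∀ a, pMap t (toNatVec (c a)) = c a) :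
    (PosDet K t).ι ⋙ pull q ⋙ dualAD K 1 ≅ (PosDet K t).ι ⋙ dualAD K t ⋙ pull c :=
  Functor.isoWhiskerLeft _ (Functor.isoWhiskerLeft _ (dualADIso K 1)) ≪≫ hs.stepIso ≪≫
    (Functor.isoWhiskerLeft _ (Functor.isoWhiskerRight (dualADIso K t) (pull c) ≪≫
      Functor.associator _ _ _ ≪≫
        Functor.isoWhiskerLeft _ (pullCompIso (pMap t) c c h0 hc))).symm

theorem IsStepPair.exists_lift_iso {t : Fin n → ℕ} {l : Fin n → ℤ}
    {q c : (Fin n → ℕ) →o (Fin n → ℤ)}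
    (hs : IsStepPair t l q c) :
    ∃ (h₁ : ∀ M, PosDet K 1 (((PosDet K t).ι ⋙ pull q ⋙ dualAD K 1).obj M))
      (h₂ : ∀ M, PosDet K 1 (((PosDet K t).ι ⋙ dualAD K t ⋙ pull c).obj M)),
      Nonempty
        ((PosDet K 1).lift ((PosDet K t).ι ⋙ pull q ⋙ dualAD K 1) h₁ ≅
          (PosDet K 1).lift ((PosDet K t).ι ⋙ dualAD K t ⋙ pull c) h₂) := by
  have h0 : ∀ a, 0 ≤ c a := fun a i => by
    have := hs.nonneg i
    change 0 ≤ c a i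
    by_cases h : 1 ≤ a i
    · rw [hs.c_of_pos a i h]; omega
    · rw [hs.c_of_zero a i (by omega)]
  have hc : ∀ a, pMap t (toNatVec (c a)) = c a := fun a => by
    have h1 : ∀ i, 0 ≤ c a i ∧ c a i ≤ t i := fun i => by
      have := hs.nonneg i
      have := hs.lt i
      by_cases h : 1 ≤ a i
      · rw [hs.c_of_pos a i h]; omega
      · rw [hs.c_of_zero a i (by omega)]; omega
    funext i
    have := h1 i
    change (if (c a i).toNat < t i then ((c a i).toNat : ℤ) else t i) = c a i
    split_ifs <;> omega
  have e₁ := Functor.isoWhiskerLeft (PosDet K t).ι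
    (Functor.isoWhiskerLeft (pull q) (dualADIso K 1)) ≪≫ hs.stepIso
  have e := hs.dualIso (K := K) h0 hc
  have h₁ : ∀ M, PosDet K 1 (((PosDet K t).ι ⋙ pull q ⋙ dualAD K 1).obj M) := fun M =>
    (hs.posDet_one M.property).of_iso (e₁.app M).symm
  exact ⟨h₁, fun M => (h₁ M).of_iso (e.app M),
    ⟨(Functor.FullyFaithful.whiskeringRight (PosDet K 1).fullyFaithfulι _).preimageIso e⟩⟩

end MultigradedModule

end

open MultigradedModule in
theorem proposition4p2 {K : Type*} [Field K] (n : ℕ) (t : Fin n → ℕ) (ht : ∀ i, 1 ≤ t i) :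
    -- `A_1 ∘ D_1 ∘ r^* ≅ p_1^* ∘ A_t ∘ D_t` as functors `Mod_t ⥤ Mod_1`
    (∃ (h₁ : ∀ M, PosDet K 1 (((PosDet K t).ι ⋙ pull (rMap t) ⋙ dualAD K 1).obj M))
      (h₂ : ∀ M, PosDet K 1 (((PosDet K t).ι ⋙ dualAD K t ⋙ pull (pMap 1)).obj M)),
      Nonempty
        ((PosDet K 1).lift ((PosDet K t).ι ⋙ pull (rMap t) ⋙ dualAD K 1) h₁ ≅
          (PosDet K 1).lift ((PosDet K t).ι ⋙ dualAD K t ⋙ pull (pMap 1)) h₂)) ∧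
    -- `r^* ∘ A_t ∘ D_t ≅ A_1 ∘ D_1 ∘ s^*` as functors `Mod_t ⥤ Mod_1`
    (∃ (h₃ : ∀ M, PosDet K 1 (((PosDet K t).ι ⋙ dualAD K t ⋙ pull (rMap t)).obj M))
      (h₄ : ∀ M, PosDet K 1 (((PosDet K t).ι ⋙ pull (sMap t) ⋙ dualAD K 1).obj M)),
      Nonempty
        ((PosDet K 1).lift ((PosDet K t).ι ⋙ dualAD K t ⋙ pull (rMap t)) h₃ ≅
          (PosDet K 1).lift ((PosDet K t).ι ⋙ pull (sMap t) ⋙ dualAD K 1) h₄)) := by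
  refine ⟨(isStepPair_rMap ht).exists_lift_iso, ?_⟩
  obtain ⟨h₄, h₃, ⟨e⟩⟩ := (isStepPair_sMap ht).exists_lift_iso (K := K)
  exact ⟨h₃, h₄, ⟨e.symm⟩⟩
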